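/- Let $(M^m,g)$ be a compact smooth Riemannian manifold without boundary, let $(N^{m+1},h)$ be an Einstein manifold, i.e. a smooth Riemannian manifold with $\mathrm{Ric}^N=\lambda h$ for some constant $\lambda\in\mathbb{R}$, whose scalar curvature is nonpositive, and let $\varphi:(M^m,g)\to(N^{m+1},h)$ be a smooth isometric immersion (a compact hypersurface of $N$). For a smooth function $f:M\to(0,\infty)$, $\varphi$ is called an $f$-biharmonic map if $$\tau_{2,f}(\varphi):=f\,\tau_2(\varphi)+(\Delta f)\,\tau(\varphi)+2\nabla^{\varphi}_{\mathrm{grad} f}\tau(\varphi)=0,$$ where $\tau(\varphi)=\mathrm{Trace}_g\nabla d\varphi$ is the tension field, $$\tau_2(\varphi)=\mathrm{Trace}_g\big(\nabla^{\varphi}\nabla^{\varphi}-\nabla^{\varphi}_{\nabla^M}\big)\tau(\varphi)-\mathrm{Trace}_g R^N(d\varphi,\tau(\varphi))d\varphi$$ is the bitension field, $R^N(X,Y)Z=[\nabla^N_X,\nabla^N_Y]Z-\nabla^N_{[X,Y]}Z$, and $\nabla^\varphi$ is the connection on $\varphi^*TN$ induced by the Levi-Civita connection of $h$. The hypersurface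 is called $f$-biharmonic if $\varphi$ is an $f$-biharmonic map for some smooth positive function $f$ on $M$, and minimal if its mean curvature vector field (the trace of the second fundamental form divided by $m$) vanishes identically. Then the hypersurface is $f$-biharmonic if and only if it is minimal. Moreover, for every smooth function $f:M\to(0,\infty)$, $\varphi$ is an $f$-biharmonic map if and only if the hypersurface is minimal. -/

import Mathlib

open scoped Manifold ContDiff

noncomputable section

namespace RiemGeom

/-- The model space `ℝᵐ`. -/
abbrev Eucl (m : ℕ) : Type := EuclideanSpace ℝ (Fin m)

/-! ### Classical tensor calculus in a coordinate domain

A metric on (an open subset of) `ℝᵐ` is given by its coefficient matrix `G y = (g_ij(y))`; a map into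
a coordinate domain of `ℝⁿ`, or a vector field along such a map, is given by its components. -/

/-- A map into `ℝⁿ`, or a field of vectors of `ℝⁿ`, given on `ℝᵐ` by its components. -/
abbrev Comps (m n : ℕ) : Type := Fin n → Eucl m → ℝ

/-- The partial derivative `∂u/∂yⁱ`. -/
def pd {m : ℕ} (i : Fin m) (u : Eucl m → ℝ) (y : Eucl m) : ℝ :=
  fderiv ℝ u y (EuclideanSpace.single i 1)

/-- The Christoffel symbols `Γᵏ_ij` of the Levi-Civita connection of `G`. -/
def christoffel {m : ℕ} (G : Eucl m → Matrix (Fin m) (Fin m) ℝ) (k i j : Fin m) (y : Eucl m) : ℝ :=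
  (1 / 2) * ∑ l, (G y)⁻¹ k l *
    (pd i (fun z => G z j l) y + pd j (fun z => G z i l) y - pd l (fun z => G z i j) y)

/-- The components of the curvature operator `R(X,Y)Z = [∇_X, ∇_Y]Z - ∇_[X,Y] Z`:
`R(∂_i, ∂_j) ∂_k = ∑ l, curv G l i j k • ∂_l`. -/
def curv {m : ℕ} (G : Eucl m → Matrix (Fin m) (Fin m) ℝ) (l i j k : Fin m) (y : Eucl m) : ℝ :=
  pd i (christoffel G l j k) y - pd j (christoffel G l i k) y
    + ∑ s, (christoffel G l i s y * christoffel G s j k y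
        - christoffel G l j s y * christoffel G s i k y)

/-- The Ricci tensor `Ric(∂_j, ∂_k)`, where `Ric(Y,Z)` is the trace of `X ↦ R(X,Y)Z`. -/
def ricci {m : ℕ} (G : Eucl m → Matrix (Fin m) (Fin m) ℝ) (j k : Fin m) (y : Eucl m) : ℝ :=
  ∑ i, curv G i i j k y

/-- The scalar curvature, the trace of the Ricci tensor with respect to the metric. -/
def scal {m : ℕ} (G : Eucl m → Matrix (Fin m) (Fin m) ℝ) (y : Eucl m) : ℝ :=
  ∑ j, ∑ k, (G y)⁻¹ j k * ricci G j k y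

/-- The gradient `(grad u)ⁱ = g^{ij} ∂_j u`. -/
def grad {m : ℕ} (G : Eucl m → Matrix (Fin m) (Fin m) ℝ) (u : Eucl m → ℝ) (i : Fin m)
    (y : Eucl m) : ℝ :=
  ∑ j, (G y)⁻¹ i j * pd j u y

/-- The Laplace-Beltrami operator `Δu = g^{ij} (∂_i ∂_j u - Γᵏ_ij ∂_k u)`. -/
def laplacian {m : ℕ} (G : Eucl m → Matrix (Fin m) (Fin m) ℝ) (u : Eucl m → ℝ) (y : Eucl m) : ℝ :=
  ∑ i, ∑ j, (G y)⁻¹ i j * (pd i (pd j u) y - ∑ k, christoffel G k i j y * pd k u y)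

section AlongMap

variable {m n : ℕ} (G : Eucl m → Matrix (Fin m) (Fin m) ℝ)
  (K : Eucl n → Matrix (Fin n) (Fin n) ℝ) (F : Eucl m → Eucl n)

/-- The components of the coordinate vectors pushed forward by `F`: `dF(∂_j) = (∂_j Fᵃ)_a`. -/
def push (j : Fin m) : Comps m n := fun a y => pd j (fun z => F z a) y

/-- The connection induced along `F` by the Levi-Civita connection of `K`:
`(∇_{∂_i} V)ᵃ = ∂_i Vᵃ + Γᵃ_bc(F) ∂_i Fᵇ Vᶜ`. -/
def covAlong (V : Comps m n) (i : Fin m) : Comps m n := fun a y =>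
  pd i (V a) y + ∑ b, ∑ c, christoffel K a b c (F y) * push F i b y * V c y

/-- The tension field `τ(F) = Trace_g (∇ dF)`,
`τ = g^{ij} (∇_{∂_i} (dF ∂_j) - dF (∇_{∂_i} ∂_j))`. -/
def tension : Comps m n := fun a y =>
  ∑ i, ∑ j, (G y)⁻¹ i j *
    (covAlong K F (push F j) i a y - ∑ k, christoffel G k i j y * push F k a y)

/-- The rough Laplacian `Trace_g (∇∇ - ∇_∇) V` of a vector field `V` along `F`. -/
def roughLaplacian (V : Comps m n) : Comps m n := fun a y =>
  ∑ i, ∑ j, (G y)⁻¹ i j *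
    (covAlong K F (covAlong K F V j) i a y - ∑ k, christoffel G k i j y * covAlong K F V k a y)

/-- The curvature term `Trace_g R(dF, V) dF`. -/
def curvTrace (V : Comps m n) : Comps m n := fun a y =>
  ∑ i, ∑ j, (G y)⁻¹ i j *
    ∑ b, ∑ c, ∑ d, curv K a b c d (F y) * push F i b y * V c y * push F j d y

/-- The bitension field `τ₂(F) = Trace_g (∇∇ - ∇_∇) τ(F) - Trace_g R(dF, τ(F)) dF`. -/
def bitension : Comps m n := fun a y =>
  roughLaplacian G K F (tension G K F) a y - curvTrace G K F (tension G K F) a y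

/-- The `f`-bitension field
`τ_{2,f}(F) = f τ₂(F) + (Δf) τ(F) + 2 ∇_{grad f} τ(F)`. -/
def fBitension (f : Eucl m → ℝ) : Comps m n := fun a y =>
  f y * bitension G K F a y + laplacian G f y * tension G K F a y
    + 2 * ∑ i, grad G f i y * covAlong K F (tension G K F) i a y

/-- The component normal to the image of `dF` of a vector field `V` along an isometric immersion
`F`: `V - g^{kl} ⟨V, dF ∂_k⟩ dF ∂_l`. -/
def normalPart (V : Comps m n) : Comps m n := fun a y =>
  V a y - ∑ k, ∑ l, (G y)⁻¹ k l *
    (∑ b, ∑ c, K (F y) b c * V b y * push F k c y) * push F l a y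

/-- The second fundamental form `B(∂_i, ∂_j) = (∇_{∂_i} (dF ∂_j))^⊥` of an isometric immersion. -/
def secondFF (i j : Fin m) : Comps m n := normalPart G K F (covAlong K F (push F j) i)

/-- The mean curvature vector field `η = (1/m) Trace_g B` of an isometric immersion. -/
def meanCurv : Comps m n := fun a y =>
  (1 / (m : ℝ)) * ∑ i, ∑ j, (G y)⁻¹ i j * secondFF G K F i j a y

end AlongMap

/-! ### Riemannian manifolds -/

/-- A smooth Riemannian metric on the smooth `m`-dimensional manifold `M`. -/
abbrev Metric (m : ℕ) (M : Type*) [TopologicalSpace M] [ChartedSpace (Eucl m) M]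
    [IsManifold (𝓡 m) ∞ M] : Type _ :=
  Bundle.ContMDiffRiemannianMetric (𝓡 m) ∞ (Eucl m) (fun x : M => TangentSpace (𝓡 m) x)

section OneManifold

variable {m : ℕ} {M : Type*} [TopologicalSpace M] [ChartedSpace (Eucl m) M]
  [IsManifold (𝓡 m) ∞ M]

/-- The coordinate vector `∂_i` of the chart `c`, at the point with coordinates `y`. -/
def coordVec (c : OpenPartialHomeomorph M (Eucl m)) (i : Fin m) (y : Eucl m) :
    TangentSpace (𝓡 m) (c.symm y) :=
  mfderiv (𝓡 m) (𝓡 m) c.symm y (EuclideanSpace.single i 1 : Eucl m)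

/-- The coefficients `g_ij = g(∂_i, ∂_j)` of a Riemannian metric in the chart `c`. -/
def coeff (g : Metric m M) (c : OpenPartialHomeomorph M (Eucl m)) (y : Eucl m) :
    Matrix (Fin m) (Fin m) ℝ :=
  Matrix.of fun i j => g.inner (c.symm y) (coordVec c i y) (coordVec c j y)

/-- `(M, g)` is an Einstein space: `Ric = μ g` for a constant `μ`. -/
def IsEinstein (g : Metric m M) : Prop :=
  ∃ μ : ℝ, ∀ c ∈ IsManifold.maximalAtlas (𝓡 m) ∞ M, ∀ y ∈ c.target, ∀ i j : Fin m,
    ricci (coeff g c) i j y = μ * coeff g c y i j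

/-- The scalar curvature of `(M, g)` is nowhere positive. -/
def NonposScal (g : Metric m M) : Prop :=
  ∀ c ∈ IsManifold.maximalAtlas (𝓡 m) ∞ M, ∀ y ∈ c.target, scal (coeff g c) y ≤ 0

end OneManifold

section TwoManifolds

variable {m n : ℕ} {M : Type*} [TopologicalSpace M] [ChartedSpace (Eucl m) M]
  [IsManifold (𝓡 m) ∞ M] {N : Type*} [TopologicalSpace N] [ChartedSpace (Eucl n) N]
  [IsManifold (𝓡 n) ∞ N]

/-- `φ : (M, g) → (N, h)` is a smooth isometric immersion, that is, `φ^* h = g`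
(the differential is then injective because `g` is positive definite). -/
structure IsIsometricImmersion (g : Metric m M) (h : Metric n N) (φ : M → N) : Prop where
  smooth : ContMDiff (𝓡 m) (𝓡 n) ∞ φ
  isometric : ∀ (x : M) (u v : TangentSpace (𝓡 m) x),
    h.inner (φ x) (mfderiv (𝓡 m) (𝓡 n) φ x u) (mfderiv (𝓡 m) (𝓡 n) φ x v) = g.inner x u v

/-- The expression of `φ` in the charts `c` and `d`. -/
def localRep (φ : M → N) (c : OpenPartialHomeomorph M (Eucl m))
    (d : OpenPartialHomeomorph N (Eucl n)) (y : Eucl m) : Eucl n :=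
  d (φ (c.symm y))

/-- `φ` satisfies the `f`-biharmonic map equation `τ_{2,f}(φ) = 0` (in all smooth charts). -/
def IsFBiharmonicMap (g : Metric m M) (h : Metric n N) (f : M → ℝ) (φ : M → N) : Prop :=
  ∀ c ∈ IsManifold.maximalAtlas (𝓡 m) ∞ M, ∀ d ∈ IsManifold.maximalAtlas (𝓡 n) ∞ N,
    ∀ y ∈ c.target, φ (c.symm y) ∈ d.source → ∀ a : Fin n,
      fBitension (coeff g c) (coeff h d) (localRep φ c d) (fun z => f (c.symm z)) a y = 0

/-- The submanifold with isometric immersion `φ` is `f`-biharmonic: `φ` is an `f`-biharmonic map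
for some smooth positive function `f`. -/
def IsFBiharmonicSubmanifold (g : Metric m M) (h : Metric n N) (φ : M → N) : Prop :=
  ∃ f : M → ℝ, ContMDiff (𝓡 m) 𝓘(ℝ, ℝ) ∞ f ∧ (∀ x, 0 < f x) ∧ IsFBiharmonicMap g h f φ

/-- The submanifold with isometric immersion `φ` is minimal: its mean curvature vector field
vanishes (in all smooth charts). -/
def IsMinimal (g : Metric m M) (h : Metric n N) (φ : M → N) : Prop :=
  ∀ c ∈ IsManifold.maximalAtlas (𝓡 m) ∞ M, ∀ d ∈ IsManifold.maximalAtlas (𝓡 n) ∞ N,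
    ∀ y ∈ c.target, φ (c.symm y) ∈ d.source → ∀ a : Fin n,
      meanCurv (coeff g c) (coeff h d) (localRep φ c d) a y = 0

end TwoManifolds

end RiemGeom

end

noncomputable section

namespace RiemGeom

open Filter Topology
open scoped Bundle

/-! ### Partial derivatives, and the second-order condition at a local maximum. -/

section Calculus

variable {m n : ℕ}

/-! The weight can be absorbed. With W = f τ, the product rule turns the f-biharmonic equation into
the Jacobi-type equation Trace(∇∇ - ∇_∇)W = Trace R(dφ, W)dφ (`fBitension_eq`). Since W is normal
and the codimension is one, pairing the right side with W gives -Ric(W,W) (`form_curvTrace`), which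
is -μ|W|² on an Einstein manifold with Ric = μh. Here μ ≤ 0, because the scalar curvature is (m+1)μ.

The Bochner formula then reads ½Δ|W|² = |∇W|² - μ|W|². By compactness |W|² attains a maximum, where
the left side is nonpositive (`form_roughLaplacian_add_nonpos`). Both terms on the right are
nonnegative, so ∇W = 0 at that point. Differentiating ⟨W, dφ(∂_j)⟩ = 0 there gives ⟨W, ∇_i dφ(∂_j)⟩
= 0; tracing gives ⟨W, τ⟩ = f|τ|² = 0 (`form_tension_eq_zero_of_covAlong_eq_zero`). Thus the maximum
of |W|² is 0, and τ vanishes everywhere (`tension_eq_zero_of_isLocalMax`,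
`IsFBiharmonicMap.isMinimal`). Evaluating at a maximum avoids integration, orientability and
connectedness.

Everything pointwise is computed in charts. The one global object is the function |fτ|², and its
independence of charts (`tensionNormSq_eq`) holds because transition maps are isometries of the
coordinate metrics, hence totally geodesic. Conversely, for an isometric immersion the mean
curvature is τ/m, and τ ≡ 0 makes every term of the f-bitension field vanish. -/

theorem pd_congr {u v : Eucl m → ℝ} {y : Eucl m} (h : u =ᶠ[𝓝 y] v) (i : Fin m) :
    pd i u y = pd i v y := by
  simp only [pd, h.fderiv_eq]

theorem pd_eventuallyEq {u v : Eucl m → ℝ} {y : Eucl m} (h : u =ᶠ[𝓝 y] v) (i : Fin m) :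
    pd i u =ᶠ[𝓝 y] pd i v :=
  h.eventuallyEq_nhds.mono fun _ hz => pd_congr hz i

theorem pd_const (i : Fin m) (a : ℝ) (y : Eucl m) : pd i (fun _ => a) y = 0 := by
  simp [pd]

theorem pd_add {u v : Eucl m → ℝ} {y : Eucl m} (hu : ContDiffAt ℝ ∞ u y)
    (hv : ContDiffAt ℝ ∞ v y) (i : Fin m) :
    pd i (fun z => u z + v z) y = pd i u y + pd i v y := by
  simp only [pd]
  rw [fderiv_fun_add (hu.differentiableAt (by simp)) (hv.differentiableAt (by simp))]
  rfl

theorem pd_mul {u v : Eucl m → ℝ} {y : Eucl m} (hu : ContDiffAt ℝ ∞ u y)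
    (hv : ContDiffAt ℝ ∞ v y) (i : Fin m) :
    pd i (fun z => u z * v z) y = pd i u y * v y + u y * pd i v y := by
  simp only [pd]
  rw [fderiv_fun_mul (hu.differentiableAt (by simp)) (hv.differentiableAt (by simp))]
  simp
  ring

theorem pd_sum {ι : Type*} (s : Finset ι) {u : ι → Eucl m → ℝ} {y : Eucl m}
    (hu : ∀ j ∈ s, ContDiffAt ℝ ∞ (u j) y) (i : Fin m) :
    pd i (fun z => ∑ j ∈ s, u j z) y = ∑ j ∈ s, pd i (u j) y := by
  simp only [pd]
  rw [fderiv_fun_sum fun j hj => (hu j hj).differentiableAt (by simp)]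
  simp

theorem contDiffAt_pd {u : Eucl m → ℝ} {y : Eucl m} (hu : ContDiffAt ℝ ∞ u y) (i : Fin m) :
    ContDiffAt ℝ ∞ (pd i u) y :=
  (hu.fderiv_right (m := ∞) (by simp)).clm_apply contDiffAt_const

theorem sum_smul_single (v : Eucl m) : v = ∑ i, v i • EuclideanSpace.single i (1 : ℝ) := by
  ext j
  simp [Pi.single_apply]

theorem fderiv_apply_eq_sum_pd (u : Eucl m → ℝ) (y v : Eucl m) :
    fderiv ℝ u y v = ∑ i, v i * pd i u y := by
  conv_lhs => rw [sum_smul_single v]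
  simp [pd]

theorem contDiffAt_coord {F : Eucl m → Eucl n} {y : Eucl m} (hF : ContDiffAt ℝ ∞ F y)
    (a : Fin n) : ContDiffAt ℝ ∞ (fun z => F z a) y :=
  (contDiffAt_piLp_apply (p := 2)).comp y hF

theorem fderiv_apply_coord {F : Eucl m → Eucl n} {y : Eucl m} (hF : ContDiffAt ℝ ∞ F y)
    (v : Eucl m) (a : Fin n) : fderiv ℝ F y v a = fderiv ℝ (fun z => F z a) y v := by
  have h := (EuclideanSpace.proj (𝕜 := ℝ) a).hasFDerivAt.comp y
    (hF.differentiableAt (by simp)).hasFDerivAt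
  have h2 : HasFDerivAt (fun z => F z a) _ y := h
  rw [h2.fderiv]
  rfl

theorem pd_comp {u : Eucl n → ℝ} {F : Eucl m → Eucl n} {y : Eucl m}
    (hu : ContDiffAt ℝ ∞ u (F y)) (hF : ContDiffAt ℝ ∞ F y) (i : Fin m) :
    pd i (fun z => u (F z)) y = ∑ b, pd b u (F y) * push F i b y := by
  have h := (hu.differentiableAt (by simp)).hasFDerivAt.comp y
    (hF.differentiableAt (by simp)).hasFDerivAt
  have h2 : HasFDerivAt (fun z => u (F z)) _ y := h
  rw [pd, h2.fderiv, ContinuousLinearMap.comp_apply, fderiv_apply_eq_sum_pd]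
  refine Finset.sum_congr rfl fun b _ => ?_
  rw [fderiv_apply_coord hF, mul_comm]
  rfl

theorem pd_comm {u : Eucl m → ℝ} {y : Eucl m} (hu : ContDiffAt ℝ ∞ u y) (i j : Fin m) :
    pd i (pd j u) y = pd j (pd i u) y := by
  have key : ∀ i j : Fin m, pd i (pd j u) y
      = fderiv ℝ (fderiv ℝ u) y (EuclideanSpace.single i 1) (EuclideanSpace.single j 1) := by
    intro i j
    have h1 : DifferentiableAt ℝ (fderiv ℝ u) y :=
      (hu.fderiv_right (m := ∞) (by simp)).differentiableAt (by simp)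
    have h2 := h1.hasFDerivAt.clm_apply
      (hasFDerivAt_const (EuclideanSpace.single j (1 : ℝ)) y)
    have h3 : HasFDerivAt (pd j u) _ y := h2
    rw [pd, h3.fderiv]
    simp
  rw [key, key]
  exact hu.isSymmSndFDerivAt (by simpa using ENat.LEInfty.out) _ _

theorem pd_eq_zero_of_isLocalMax {u : Eucl m → ℝ} {y : Eucl m} (h : IsLocalMax u y) (i : Fin m) :
    pd i u y = 0 := by
  simp [pd, h.fderiv_eq_zero]

/-- The sum is the second derivative of u along the line through y in direction v. Were it positive,
the second derivative test would make the point a local minimum as well; u would be locally constant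
on the line and the second derivative zero. -/
theorem sum_pd_pd_nonpos_of_isLocalMax {u : Eucl m → ℝ} {y : Eucl m} (hu : ContDiffAt ℝ ∞ u y)
    (h : IsLocalMax u y) (v : Fin m → ℝ) : ∑ i, ∑ j, v i * v j * pd i (pd j u) y ≤ 0 := by
  set w : Eucl m := WithLp.toLp 2 v with hw
  have hline : ∀ t : ℝ, HasDerivAt (fun t : ℝ => y + t • w) w t := fun t => by
    simpa using ((hasDerivAt_id t).smul_const w).const_add y
  have hcont : ContinuousAt (fun t : ℝ => y + t • w) 0 := (hline 0).continuousAt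
  have htend : Tendsto (fun t : ℝ => y + t • w) (𝓝 0) (𝓝 y) := by
    simpa [ContinuousAt] using hcont
  have hder : ∀ u' : Eucl m → ℝ, ∀ t : ℝ, DifferentiableAt ℝ u' (y + t • w) →
      HasDerivAt (fun t : ℝ => u' (y + t • w)) (∑ i, v i * pd i u' (y + t • w)) t := by
    intro u' t hd
    have := hd.hasFDerivAt.comp_hasDerivAt t (hline t)
    rwa [fderiv_apply_eq_sum_pd] at this
  have hev : ∀ᶠ t in 𝓝 (0 : ℝ), DifferentiableAt ℝ u (y + t • w) := by
    have : ∀ᶠ z in 𝓝 y, ContDiffAt ℝ 1 u z := (hu.of_le (by simp)).eventually (by simp)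
    exact (htend.eventually this).mono fun t ht => ht.differentiableAt (by simp)
  set g : ℝ → ℝ := fun t => u (y + t • w) with hg
  have hd1 : deriv g =ᶠ[𝓝 0] fun t => ∑ i, v i * pd i u (y + t • w) :=
    hev.mono fun t ht => (hder u t ht).deriv
  have hd2 : deriv (deriv g) 0 = ∑ i, ∑ j, v i * v j * pd i (pd j u) y := by
    rw [hd1.deriv_eq]
    have : HasDerivAt (fun t : ℝ => ∑ j, v j * pd j u (y + t • w))
        (∑ j, v j * ∑ i, v i * pd i (pd j u) (y + (0 : ℝ) • w)) 0 := by
      refine HasDerivAt.fun_sum fun j _ => (hder (pd j u) 0 ?_).const_mul _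
      simpa using (contDiffAt_pd hu j).differentiableAt (by simp)
    rw [this.deriv, Finset.sum_comm' (s := Finset.univ) (t := fun _ => Finset.univ)
      (t' := Finset.univ) (s' := fun _ => Finset.univ) (by simp)]
    refine Finset.sum_congr rfl fun j _ => ?_
    rw [Finset.mul_sum]
    refine Finset.sum_congr rfl fun i _ => ?_
    simp
    ring
  have hmax : IsLocalMax g 0 := by
    have : ∀ᶠ z in 𝓝 y, u z ≤ u y := h
    refine (htend.eventually this).mono fun t ht => ?_
    simpa [hg] using ht
  rw [← hd2]
  by_contra! hpos
  have hgc : ContinuousAt g 0 := by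
    have : DifferentiableAt ℝ u (y + (0 : ℝ) • w) := by
      simpa using hu.differentiableAt (by simp)
    exact (hder u 0 this).continuousAt
  have hmin := isLocalMin_of_deriv_deriv_pos hpos hmax.deriv_eq_zero hgc
  have hconst : g =ᶠ[𝓝 0] fun _ => g 0 := by
    filter_upwards [hmin, hmax] with t h1 h2 using le_antisymm h2 h1
  have h0 : deriv g =ᶠ[𝓝 0] fun _ => 0 := by
    filter_upwards [hconst.eventuallyEq_nhds] with t ht
    rw [ht.deriv_eq]
    simp
  rw [h0.deriv_eq] at hpos
  simp at hpos

open scoped MatrixOrder ComplexOrder in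
/-- A positive semidefinite real matrix is a Gram matrix. -/
theorem exists_gram_of_posSemidef {P : Matrix (Fin m) (Fin m) ℝ} (hP : P.PosSemidef) :
    ∃ B : Matrix (Fin m) (Fin m) ℝ, ∀ i j, P i j = ∑ k, B k i * B k j := by
  obtain ⟨B, hB⟩ := CStarAlgebra.nonneg_iff_eq_star_mul_self.mp hP.nonneg
  refine ⟨B, fun i j => ?_⟩
  simp [hB, Matrix.mul_apply, Matrix.star_apply]

/-- Factoring P as a Gram matrix splits the trace into second derivatives in the directions of the
rows of B. It is applied with P the inverse metric. -/
theorem trace_hess_nonpos_of_isLocalMax {u : Eucl m → ℝ} {y : Eucl m} (hu : ContDiffAt ℝ ∞ u y)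
    (h : IsLocalMax u y) {P : Matrix (Fin m) (Fin m) ℝ} (hP : P.PosSemidef) :
    ∑ i, ∑ j, P i j * pd i (pd j u) y ≤ 0 := by
  obtain ⟨B, hB⟩ := exists_gram_of_posSemidef hP
  have : ∑ i, ∑ j, P i j * pd i (pd j u) y
      = ∑ k, ∑ i, ∑ j, B k i * B k j * pd i (pd j u) y := by
    simp only [hB, Finset.sum_mul]
    rw [Finset.sum_comm]
    conv_rhs => rw [Finset.sum_comm]; enter [2, i]; rw [Finset.sum_comm]
    rw [Finset.sum_comm]
  rw [this]
  exact Finset.sum_nonpos fun k _ => sum_pd_pd_nonpos_of_isLocalMax hu h _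

/-- The coefficients of the inverse of a smooth family of invertible matrices are smooth. -/
theorem contDiffAt_inv {G : Eucl m → Matrix (Fin n) (Fin n) ℝ} {y : Eucl m}
    (hG : ∀ i j, ContDiffAt ℝ ∞ (fun z => G z i j) y) (hdet : (G y).det ≠ 0) (i j : Fin n) :
    ContDiffAt ℝ ∞ (fun z => (G z)⁻¹ i j) y := by
  have hd : ∀ A : Eucl m → Matrix (Fin n) (Fin n) ℝ,
      (∀ i j, ContDiffAt ℝ ∞ (fun z => A z i j) y) → ContDiffAt ℝ ∞ (fun z => (A z).det) y := by
    intro A hA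
    simp only [Matrix.det_apply]
    refine ContDiffAt.sum fun σ _ => ?_
    refine ContDiffAt.const_smul _ ?_
    exact contDiffAt_prod fun i _ => hA _ _
  -- Cramer's rule: the entry is a quotient of determinants, which are polynomial in the entries of
  -- G.
  have : ∀ z, (G z)⁻¹ i j = ((G z).det)⁻¹ * ((G z).updateRow j (Pi.single i 1)).det := by
    intro z
    rw [Matrix.inv_def, Matrix.smul_apply, Matrix.adjugate_apply, Ring.inverse_eq_inv', smul_eq_mul]
  simp only [this]
  refine ((hd G hG).inv hdet).mul (hd _ fun k l => ?_)
  by_cases hk : k = j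
  · subst hk
    simpa using contDiffAt_const
  · simpa [Matrix.updateRow_apply, hk] using hG k l

end Calculus

/-! ### Riemannian metrics on coordinate domains -/

section Form

variable {m n : ℕ}

/-- The bilinear form with Gram matrix `A`. -/
def form (A : Matrix (Fin n) (Fin n) ℝ) : (Fin n → ℝ) →ₗ[ℝ] (Fin n → ℝ) →ₗ[ℝ] ℝ :=
  Matrix.toLinearMap₂' ℝ A

theorem form_apply (A : Matrix (Fin n) (Fin n) ℝ) (v w : Fin n → ℝ) :
    form A v w = ∑ b, ∑ c, A b c * v b * w c := by
  simp only [form, Matrix.toLinearMap₂'_apply, smul_eq_mul]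
  refine Finset.sum_congr rfl fun b _ => Finset.sum_congr rfl fun c _ => ?_
  ring

theorem form_comm {A : Matrix (Fin n) (Fin n) ℝ} (hA : ∀ i j, A i j = A j i) (v w : Fin n → ℝ) :
    form A v w = form A w v := by
  rw [form_apply, form_apply, Finset.sum_comm]
  refine Finset.sum_congr rfl fun b _ => Finset.sum_congr rfl fun c _ => ?_
  rw [hA c b]
  ring

theorem posDef_symm {A : Matrix (Fin n) (Fin n) ℝ} (hA : A.PosDef) (i j : Fin n) :
    A i j = A j i := by
  simpa using (hA.1.apply i j).symm

theorem form_self_pos {A : Matrix (Fin n) (Fin n) ℝ} (hA : A.PosDef) {v : Fin n → ℝ}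
    (hv : v ≠ 0) : 0 < form A v v := by
  have := hA.dotProduct_mulVec_pos hv
  rw [form_apply]
  simpa [dotProduct, Matrix.mulVec, Finset.mul_sum, mul_comm, mul_assoc, mul_left_comm] using this

theorem form_self_nonneg {A : Matrix (Fin n) (Fin n) ℝ} (hA : A.PosDef) (v : Fin n → ℝ) :
    0 ≤ form A v v := by
  by_cases hv : v = 0
  · simp [hv]
  · exact (form_self_pos hA hv).le

theorem eq_zero_of_form_self_nonpos {A : Matrix (Fin n) (Fin n) ℝ} (hA : A.PosDef)
    {v : Fin n → ℝ} (h : form A v v ≤ 0) : v = 0 := by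
  by_contra hv
  exact absurd (form_self_pos hA hv) (not_lt.2 h)

theorem sum_mul_sum_inv_mul {A : Matrix (Fin n) (Fin n) ℝ} (hA : A.det ≠ 0) (t : Fin n → ℝ)
    (l : Fin n) : ∑ k, A l k * ∑ p, A⁻¹ k p * t p = t l := by
  change Matrix.mulVec A (Matrix.mulVec A⁻¹ t) l = t l
  rw [Matrix.mulVec_mulVec, Matrix.mul_nonsing_inv _ hA.isUnit, Matrix.one_mulVec]

theorem sum_inv_mul_sum_mul {A : Matrix (Fin n) (Fin n) ℝ} (hA : A.det ≠ 0) (t : Fin n → ℝ)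
    (l : Fin n) : ∑ k, A⁻¹ l k * ∑ p, A k p * t p = t l := by
  change Matrix.mulVec A⁻¹ (Matrix.mulVec A t) l = t l
  rw [Matrix.mulVec_mulVec, Matrix.nonsing_inv_mul _ hA.isUnit, Matrix.one_mulVec]

/-- If `∑ P_ij ⟨v_i, v_j⟩ ≤ 0` with `P` and `⟨·,·⟩` positive definite, then every `v_i` vanishes. -/
theorem eq_zero_of_sum_form_nonpos {A : Matrix (Fin n) (Fin n) ℝ} (hA : A.PosDef)
    {P : Matrix (Fin m) (Fin m) ℝ} (hP : P.PosDef) {v : Fin m → Fin n → ℝ}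
    (h : ∑ i, ∑ j, P i j * form A (v i) (v j) ≤ 0) (i : Fin m) : v i = 0 := by
  obtain ⟨B, hB⟩ := exists_gram_of_posSemidef hA.posSemidef
  have hform : ∀ x y : Fin n → ℝ,
      form A x y = ∑ k, (∑ b, B k b * x b) * (∑ c, B k c * y c) := by
    intro x y
    simp only [form_apply, hB, Finset.sum_mul, Finset.mul_sum]
    conv_lhs => enter [2, b]; rw [Finset.sum_comm]
    rw [Finset.sum_comm]
    refine Finset.sum_congr rfl fun k _ => ?_
    rw [Finset.sum_comm]
    refine Finset.sum_congr rfl fun b _ => Finset.sum_congr rfl fun c _ => ?_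
    ring
  -- Writing A as a sum of squares of linear forms splits the sum into values of the quadratic form
  -- P, one for each linear form. Each value is nonnegative, so each must vanish.
  have hsum : ∑ i, ∑ j, P i j * form A (v i) (v j)
      = ∑ k, form P (fun i => ∑ b, B k b * v i b) (fun i => ∑ b, B k b * v i b) := by
    have hterm : ∀ i j, P i j * form A (v i) (v j)
        = ∑ k, P i j * (∑ b, B k b * v i b) * (∑ b, B k b * v j b) := by
      intro i j
      rw [hform, Finset.mul_sum]
      exact Finset.sum_congr rfl fun k _ => by ring
    simp only [hterm]
    simp only [form_apply]
    conv_lhs => enter [2, i]; rw [Finset.sum_comm]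
    rw [Finset.sum_comm]
  rw [hsum] at h
  have hk : ∀ k, (fun i => ∑ b, B k b * v i b) = 0 := by
    have h0 := (Finset.sum_eq_zero_iff_of_nonneg fun k _ => form_self_nonneg hP _).1
      (le_antisymm h (Finset.sum_nonneg fun k _ => form_self_nonneg hP _))
    exact fun k => eq_zero_of_form_self_nonpos hP (h0 k (Finset.mem_univ k)).le
  refine eq_zero_of_form_self_nonpos hA ?_
  rw [hform]
  refine (Finset.sum_eq_zero fun k _ => ?_).le
  have : ∑ b, B k b * v i b = 0 := congrFun (hk k) i
  rw [this, zero_mul]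

end Form

/-! ### The Levi-Civita connection and the connection it induces along a map. -/

section LocalMetric

variable {m n : ℕ}

/-- `K` is a smooth Riemannian metric on the open set `Ω`. -/
structure IsLocalMetric (K : Eucl n → Matrix (Fin n) (Fin n) ℝ) (Ω : Set (Eucl n)) : Prop where
  isOpen : IsOpen Ω
  smooth : ∀ z ∈ Ω, ∀ i j, ContDiffAt ℝ ∞ (fun z => K z i j) z
  posDef : ∀ z ∈ Ω, (K z).PosDef

namespace IsLocalMetric

variable {K : Eucl n → Matrix (Fin n) (Fin n) ℝ} {Ω : Set (Eucl n)} (hK : IsLocalMetric K Ω)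
  {z : Eucl n}

include hK

theorem det_ne_zero (hz : z ∈ Ω) : (K z).det ≠ 0 := (hK.posDef z hz).det_pos.ne'

theorem symm (hz : z ∈ Ω) (i j : Fin n) : K z i j = K z j i := posDef_symm (hK.posDef z hz) i j

theorem inv_symm (hz : z ∈ Ω) (i j : Fin n) : (K z)⁻¹ i j = (K z)⁻¹ j i :=
  posDef_symm (hK.posDef z hz).inv i j

theorem pd_symm (hz : z ∈ Ω) (k i j : Fin n) :
    pd k (fun z => K z i j) z = pd k (fun z => K z j i) z :=
  pd_congr ((hK.isOpen.eventually_mem hz).mono fun _ hw => hK.symm hw i j) k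

theorem inv_smooth (hz : z ∈ Ω) (i j : Fin n) : ContDiffAt ℝ ∞ (fun z => (K z)⁻¹ i j) z :=
  contDiffAt_inv (hK.smooth z hz) (hK.det_ne_zero hz) i j

theorem contDiffAt_christoffel (hz : z ∈ Ω) (k i j : Fin n) :
    ContDiffAt ℝ ∞ (christoffel K k i j) z := by
  refine contDiffAt_const.mul (ContDiffAt.sum fun l _ => (hK.inv_smooth hz k l).mul ?_)
  exact ((contDiffAt_pd (hK.smooth z hz j l) i).add (contDiffAt_pd (hK.smooth z hz i l) j)).sub
    (contDiffAt_pd (hK.smooth z hz i j) l)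

theorem christoffel_comm (hz : z ∈ Ω) (k i j : Fin n) :
    christoffel K k i j z = christoffel K k j i z := by
  simp only [christoffel]
  congr 1
  refine Finset.sum_congr rfl fun l _ => ?_
  rw [hK.pd_symm hz l i j]
  ring

/-- Lowering the index cancels the inverse metric, leaving Christoffel symbols of the first kind.
Metric compatibility and the Koszul argument below both use this form. -/
theorem christoffel_lower (hz : z ∈ Ω) (l i j : Fin n) :
    ∑ k, K z l k * christoffel K k i j z = (1 / 2) *
      (pd i (fun z => K z j l) z + pd j (fun z => K z i l) z - pd l (fun z => K z i j) z) := by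
  rw [← sum_mul_sum_inv_mul (hK.det_ne_zero hz) (fun l => pd i (fun z => K z j l) z
    + pd j (fun z => K z i l) z - pd l (fun z => K z i j) z) l, Finset.mul_sum]
  refine Finset.sum_congr rfl fun k _ => ?_
  simp only [christoffel]
  ring

/-- The Levi-Civita connection is compatible with the metric. -/
theorem pd_coeff (hz : z ∈ Ω) (i b c : Fin n) : pd i (fun z => K z b c) z
    = ∑ s, K z s c * christoffel K s i b z + ∑ s, K z b s * christoffel K s i c z := by
  have h : ∀ s, K z s c = K z c s := fun s => hK.symm hz s c
  simp only [h]
  rw [hK.christoffel_lower hz, hK.christoffel_lower hz, hK.pd_symm hz i c b]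
  ring

end IsLocalMetric

/-- The value at `y` of a vector field along a map. -/
def val (V : Comps m n) (y : Eucl m) : Fin n → ℝ := fun a => V a y

/-- The matrix of the connection induced along `F`, in the direction `∂_i`. -/
def connMatrix (K : Eucl n → Matrix (Fin n) (Fin n) ℝ) (F : Eucl m → Eucl n) (i : Fin m)
    (y : Eucl m) (a c : Fin n) : ℝ :=
  ∑ b, christoffel K a b c (F y) * push F i b y

theorem covAlong_eq (K : Eucl n → Matrix (Fin n) (Fin n) ℝ) (F : Eucl m → Eucl n)
    (V : Comps m n) (i : Fin m) (a : Fin n) (y : Eucl m) :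
    covAlong K F V i a y = pd i (V a) y + ∑ c, connMatrix K F i y a c * V c y := by
  simp only [covAlong, connMatrix, Finset.sum_mul]
  rw [Finset.sum_comm]

theorem contDiffAt_push {F : Eucl m → Eucl n} {y : Eucl m} (hF : ContDiffAt ℝ ∞ F y)
    (i : Fin m) (a : Fin n) : ContDiffAt ℝ ∞ (push F i a) y :=
  contDiffAt_pd (contDiffAt_coord hF a) i

section Along

variable {K : Eucl n → Matrix (Fin n) (Fin n) ℝ} {Ω : Set (Eucl n)} (hK : IsLocalMetric K Ω)
  {F : Eucl m → Eucl n} {y : Eucl m} (hF : ContDiffAt ℝ ∞ F y) (hy : F y ∈ Ω)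

include hK hF hy

theorem contDiffAt_covAlong {V : Comps m n} (hV : ∀ a, ContDiffAt ℝ ∞ (V a) y) (i : Fin m)
    (a : Fin n) : ContDiffAt ℝ ∞ (covAlong K F V i a) y := by
  refine (contDiffAt_pd (hV a) i).add (ContDiffAt.sum fun b _ => ContDiffAt.sum fun c _ => ?_)
  exact (((hK.contDiffAt_christoffel hy a b c).comp y hF).mul (contDiffAt_push hF i b)).mul (hV c)

/-- This is torsion-freeness: second partial derivatives commute and the Christoffel symbols are
symmetric in their lower indices. -/
theorem covAlong_push_comm (i j : Fin m) (a : Fin n) :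
    covAlong K F (push F j) i a y = covAlong K F (push F i) j a y := by
  simp only [covAlong]
  congr 1
  · exact pd_comm (contDiffAt_coord hF a) i j
  · rw [Finset.sum_comm]
    refine Finset.sum_congr rfl fun b _ => Finset.sum_congr rfl fun c _ => ?_
    rw [hK.christoffel_comm hy]
    ring

theorem pd_coeff_comp (i : Fin m) (b c : Fin n) : pd i (fun z => K (F z) b c) y
    = ∑ s, K (F y) s c * connMatrix K F i y s b + ∑ s, K (F y) b s * connMatrix K F i y s c := by
  rw [pd_comp (hK.smooth _ hy b c) hF]
  simp only [hK.pd_coeff hy, connMatrix, add_mul, Finset.sum_add_distrib, Finset.sum_mul,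
    Finset.mul_sum]
  congr 1 <;> rw [Finset.sum_comm] <;>
    exact Finset.sum_congr rfl fun _ _ => Finset.sum_congr rfl fun _ _ => by ring

theorem contDiffAt_form {V W : Comps m n} (hV : ∀ a, ContDiffAt ℝ ∞ (V a) y)
    (hW : ∀ a, ContDiffAt ℝ ∞ (W a) y) :
    ContDiffAt ℝ ∞ (fun z => form (K (F z)) (val V z) (val W z)) y := by
  simp only [form_apply, val]
  exact ContDiffAt.sum fun b _ => ContDiffAt.sum fun c _ =>
    (((hK.smooth _ hy b c).comp y hF).mul (hV b)).mul (hW c)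

/-- The induced connection is compatible with the metric. -/
theorem pd_form {V W : Comps m n} (hV : ∀ a, ContDiffAt ℝ ∞ (V a) y)
    (hW : ∀ a, ContDiffAt ℝ ∞ (W a) y) (i : Fin m) :
    pd i (fun z => form (K (F z)) (val V z) (val W z)) y
      = form (K (F y)) (val (covAlong K F V i) y) (val W y)
        + form (K (F y)) (val V y) (val (covAlong K F W i) y) := by
  have hKF : ∀ b c, ContDiffAt ℝ ∞ (fun z => K (F z) b c) y :=
    fun b c => (hK.smooth _ hy b c).comp y hF
  have h1 : pd i (fun z => form (K (F z)) (val V z) (val W z)) y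
      = ∑ b, ∑ c, ((pd i (fun z => K (F z) b c) y * V b y + K (F y) b c * pd i (V b) y) * W c y
        + K (F y) b c * V b y * pd i (W c) y) := by
    simp only [form_apply, val]
    rw [pd_sum _ fun b _ => ContDiffAt.sum fun c _ => ((hKF b c).mul (hV b)).mul (hW c)]
    refine Finset.sum_congr rfl fun b _ => ?_
    rw [pd_sum _ fun c _ => ((hKF b c).mul (hV b)).mul (hW c)]
    refine Finset.sum_congr rfl fun c _ => ?_
    rw [pd_mul ((hKF b c).mul (hV b)) (hW c), pd_mul (hKF b c) (hV b)]
  rw [h1]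
  simp only [form_apply, val, covAlong_eq, pd_coeff_comp hK hF hy, mul_add, add_mul,
    Finset.sum_add_distrib, Finset.mul_sum, Finset.sum_mul]
  have e1 : ∑ b, ∑ c, ∑ s, K (F y) s c * connMatrix K F i y s b * V b y * W c y
      = ∑ b, ∑ c, ∑ s, K (F y) b c * (connMatrix K F i y b s * V s y) * W c y := by
    conv_rhs => enter [2, b]; rw [Finset.sum_comm]
    rw [Finset.sum_comm, Finset.sum_comm]
    conv_lhs => enter [2, b]; rw [Finset.sum_comm]
    rw [Finset.sum_comm]
    refine Finset.sum_congr rfl fun b _ => Finset.sum_congr rfl fun c _ =>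
      Finset.sum_congr rfl fun s _ => ?_
    ring
  have e2 : ∑ b, ∑ c, ∑ s, K (F y) b s * connMatrix K F i y s c * V b y * W c y
      = ∑ b, ∑ c, ∑ s, K (F y) b c * V b y * (connMatrix K F i y c s * W s y) := by
    refine Finset.sum_congr rfl fun b _ => ?_
    rw [Finset.sum_comm]
    refine Finset.sum_congr rfl fun c _ => Finset.sum_congr rfl fun s _ => ?_
    ring
  rw [e1, e2]
  ring

end Along

end LocalMetric

/-! ### Isometric immersions of coordinate domains -/

section LocalIsometry

variable {m n : ℕ}

/-- `F` is a smooth isometric immersion of `(U, G)` into `(Ω, K)`. -/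
structure IsLocalIsometry (G : Eucl m → Matrix (Fin m) (Fin m) ℝ) (U : Set (Eucl m))
    (K : Eucl n → Matrix (Fin n) (Fin n) ℝ) (Ω : Set (Eucl n)) (F : Eucl m → Eucl n) : Prop where
  source : IsLocalMetric G U
  target : IsLocalMetric K Ω
  mapsTo : ∀ y ∈ U, F y ∈ Ω
  smooth : ∀ y ∈ U, ContDiffAt ℝ ∞ F y
  isometric : ∀ y ∈ U, ∀ i j, form (K (F y)) (val (push F i) y) (val (push F j) y) = G y i j

/-- The second fundamental form `∇dF` of a map `F`. -/
def hess (G : Eucl m → Matrix (Fin m) (Fin m) ℝ) (K : Eucl n → Matrix (Fin n) (Fin n) ℝ)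
    (F : Eucl m → Eucl n) (i j : Fin m) : Comps m n := fun a y =>
  covAlong K F (push F j) i a y - ∑ k, christoffel G k i j y * push F k a y

theorem val_hess (G : Eucl m → Matrix (Fin m) (Fin m) ℝ) (K : Eucl n → Matrix (Fin n) (Fin n) ℝ)
    (F : Eucl m → Eucl n) (i j : Fin m) (y : Eucl m) :
    val (hess G K F i j) y = val (covAlong K F (push F j) i) y
      - ∑ k, christoffel G k i j y • val (push F k) y := by
  ext a
  simp [val, hess]

theorem val_tension (G : Eucl m → Matrix (Fin m) (Fin m) ℝ)
    (K : Eucl n → Matrix (Fin n) (Fin n) ℝ) (F : Eucl m → Eucl n) (y : Eucl m) :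
    val (tension G K F) y = ∑ i, ∑ j, (G y)⁻¹ i j • val (hess G K F i j) y := by
  ext a
  simp [val, hess, tension]

theorem val_roughLaplacian (G : Eucl m → Matrix (Fin m) (Fin m) ℝ)
    (K : Eucl n → Matrix (Fin n) (Fin n) ℝ) (F : Eucl m → Eucl n) (V : Comps m n) (y : Eucl m) :
    val (roughLaplacian G K F V) y = ∑ i, ∑ j, (G y)⁻¹ i j •
      (val (covAlong K F (covAlong K F V j) i) y
        - ∑ k, christoffel G k i j y • val (covAlong K F V k) y) := by
  ext a
  simp [val, roughLaplacian]

variable {G : Eucl m → Matrix (Fin m) (Fin m) ℝ} {U : Set (Eucl m)}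
  {K : Eucl n → Matrix (Fin n) (Fin n) ℝ} {Ω : Set (Eucl n)} {F : Eucl m → Eucl n}

theorem covAlong_congr {V W : Comps m n} {y : Eucl m} (h : ∀ a, V a =ᶠ[𝓝 y] W a) (i : Fin m)
    (a : Fin n) : covAlong K F V i a y = covAlong K F W i a y := by
  simp only [covAlong]
  rw [pd_congr (h a) i]
  congr 1
  exact Finset.sum_congr rfl fun b _ => Finset.sum_congr rfl fun c _ => by rw [(h c).eq_of_nhds]

theorem covAlong_eventuallyEq {V W : Comps m n} {y : Eucl m} (h : ∀ a, V a =ᶠ[𝓝 y] W a)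
    (i : Fin m) (a : Fin n) : covAlong K F V i a =ᶠ[𝓝 y] covAlong K F W i a := by
  have : ∀ᶠ z in 𝓝 y, ∀ a, V a =ᶠ[𝓝 z] W a :=
    eventually_all.2 fun a => (h a).eventuallyEq_nhds
  exact this.mono fun z hz => covAlong_congr hz i a

theorem covAlong_zero (i : Fin m) (a : Fin n) (y : Eucl m) :
    covAlong K F (fun _ _ => 0) i a y = 0 := by
  simp [covAlong, pd_const]

/-- The product rule for the induced connection. -/
theorem covAlong_mul {f : Eucl m → ℝ} {V : Comps m n} {y : Eucl m} (hf : ContDiffAt ℝ ∞ f y)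
    (hV : ∀ a, ContDiffAt ℝ ∞ (V a) y) (i : Fin m) (a : Fin n) :
    covAlong K F (fun a z => f z * V a z) i a y
      = pd i f y * V a y + f y * covAlong K F V i a y := by
  simp only [covAlong_eq]
  rw [pd_mul hf (hV a), mul_add, Finset.mul_sum, add_assoc]
  congr 2
  exact Finset.sum_congr rfl fun c _ => by ring

theorem covAlong_add {V W : Comps m n} {y : Eucl m}
    (hV : ∀ a, ContDiffAt ℝ ∞ (V a) y) (hW : ∀ a, ContDiffAt ℝ ∞ (W a) y) (i : Fin m)
    (a : Fin n) : covAlong K F (fun a z => V a z + W a z) i a y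
      = covAlong K F V i a y + covAlong K F W i a y := by
  simp only [covAlong_eq]
  rw [pd_add (hV a) (hW a)]
  simp only [mul_add, Finset.sum_add_distrib]
  ring

namespace IsLocalIsometry

variable (hF : IsLocalIsometry G U K Ω F) {y : Eucl m}

include hF

theorem contDiffAt_covAlong (hy : y ∈ U) {V : Comps m n} (hV : ∀ a, ContDiffAt ℝ ∞ (V a) y)
    (i : Fin m) (a : Fin n) : ContDiffAt ℝ ∞ (covAlong K F V i a) y :=
  RiemGeom.contDiffAt_covAlong hF.target (hF.smooth y hy) (hF.mapsTo y hy) hV i a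

theorem contDiffAt_push (hy : y ∈ U) (i : Fin m) (a : Fin n) : ContDiffAt ℝ ∞ (push F i a) y :=
  RiemGeom.contDiffAt_push (hF.smooth y hy) i a

theorem pd_form (hy : y ∈ U) {V W : Comps m n} (hV : ∀ a, ContDiffAt ℝ ∞ (V a) y)
    (hW : ∀ a, ContDiffAt ℝ ∞ (W a) y) (i : Fin m) :
    pd i (fun z => form (K (F z)) (val V z) (val W z)) y
      = form (K (F y)) (val (covAlong K F V i) y) (val W y)
        + form (K (F y)) (val V y) (val (covAlong K F W i) y) :=
  RiemGeom.pd_form hF.target (hF.smooth y hy) (hF.mapsTo y hy) hV hW i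

theorem form_comm (hy : y ∈ U) (v w : Fin n → ℝ) : form (K (F y)) v w = form (K (F y)) w v :=
  RiemGeom.form_comm (hF.target.symm (hF.mapsTo y hy)) v w

theorem contDiffAt_hess (hy : y ∈ U) (i j : Fin m) (a : Fin n) :
    ContDiffAt ℝ ∞ (hess G K F i j a) y :=
  (hF.contDiffAt_covAlong hy (hF.contDiffAt_push hy j) i a).sub
    (ContDiffAt.sum fun k _ => (hF.source.contDiffAt_christoffel hy k i j).mul
      (hF.contDiffAt_push hy k a))

theorem contDiffAt_tension (hy : y ∈ U) (a : Fin n) : ContDiffAt ℝ ∞ (tension G K F a) y :=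
  ContDiffAt.sum fun i _ => ContDiffAt.sum fun j _ =>
    (hF.source.inv_smooth hy i j).mul (hF.contDiffAt_hess hy i j a)

/-- The tangential part of `∇_i (dF ∂_j)` is `dF (∇_i ∂_j)`. -/
theorem form_covAlong_push (hy : y ∈ U) (i j l : Fin m) :
    form (K (F y)) (val (covAlong K F (push F j) i) y) (val (push F l) y)
      = ∑ k, G y l k * christoffel G k i j y := by
  have hpd : ∀ i j l, pd i (fun z => G z j l) y
      = form (K (F y)) (val (covAlong K F (push F j) i) y) (val (push F l) y)
        + form (K (F y)) (val (covAlong K F (push F l) i) y) (val (push F j) y) := by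
    intro i j l
    rw [hF.form_comm hy (val (covAlong K F (push F l) i) y),
      ← hF.pd_form hy (hF.contDiffAt_push hy j) (hF.contDiffAt_push hy l)]
    exact pd_congr ((hF.source.isOpen.eventually_mem hy).mono
      fun z hz => (hF.isometric z hz j l).symm) i
  have hsymm : ∀ i j, val (covAlong K F (push F j) i) y = val (covAlong K F (push F i) j) y :=
    fun i j => funext fun a =>
      covAlong_push_comm hF.target (hF.smooth y hy) (hF.mapsTo y hy) i j a
  -- The Koszul computation: in the cyclic combination of derivatives of G, metric compatibility and
  -- symmetry leave twice the wanted term.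
  rw [hF.source.christoffel_lower hy, hpd i j l, hpd j i l, hpd l i j, hsymm j i, hsymm l j,
    hsymm l i]
  ring

/-- The Gauss formula: the term dF(∇_i ∂_j) subtracted in `hess` is exactly the tangential part of
∇_i(dF ∂_j), so only a normal vector is left. -/
theorem form_hess_push (hy : y ∈ U) (i j l : Fin m) :
    form (K (F y)) (val (hess G K F i j) y) (val (push F l) y) = 0 := by
  rw [val_hess, map_sub, LinearMap.sub_apply, hF.form_covAlong_push hy]
  simp only [map_sum, map_smul, LinearMap.sum_apply, LinearMap.smul_apply, smul_eq_mul,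
    hF.isometric y hy]
  rw [sub_eq_zero]
  exact Finset.sum_congr rfl fun k _ => by rw [hF.source.symm hy l k, mul_comm]

/-- The tension field of an isometric immersion is normal. -/
theorem form_tension_push (hy : y ∈ U) (l : Fin m) :
    form (K (F y)) (val (tension G K F) y) (val (push F l) y) = 0 := by
  simp [val_tension, hF.form_hess_push hy]

/-- Projecting off the tangential part and subtracting dF(∇_i ∂_j) are the same operation, by
`form_covAlong_push`. This links mean curvature to the tension field. -/
theorem secondFF_eq_hess (hy : y ∈ U) (i j : Fin m) (a : Fin n) :
    secondFF G K F i j a y = hess G K F i j a y := by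
  simp only [secondFF, normalPart, hess]
  congr 1
  have h : ∀ k, ∑ b, ∑ c, K (F y) b c * covAlong K F (push F j) i b y * push F k c y
      = ∑ p, G y k p * christoffel G p i j y := by
    intro k
    rw [← hF.form_covAlong_push hy, form_apply]
    rfl
  simp only [h]
  rw [Finset.sum_comm]
  refine Finset.sum_congr rfl fun l _ => ?_
  rw [← Finset.sum_mul]
  congr 1
  rw [← sum_inv_mul_sum_mul (hF.source.det_ne_zero hy) (fun p => christoffel G p i j y) l]
  exact Finset.sum_congr rfl fun k _ => by rw [hF.source.inv_symm hy]

theorem meanCurv_eq (hy : y ∈ U) (a : Fin n) :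
    meanCurv G K F a y = (1 / (m : ℝ)) * tension G K F a y := by
  simp only [meanCurv, hF.secondFF_eq_hess hy]
  rfl

/-- `τ_{2,f}(F) = Trace_g (∇∇ - ∇_∇) (f τ) - Trace_g R(dF, f τ) dF`. -/
theorem fBitension_eq (hy : y ∈ U) {f : Eucl m → ℝ} (hf : ∀ z ∈ U, ContDiffAt ℝ ∞ f z)
    (a : Fin n) : fBitension G K F f a y
      = roughLaplacian G K F (fun a z => f z * tension G K F a z) a y
        - curvTrace G K F (fun a z => f z * tension G K F a z) a y := by
  set V := tension G K F with hVdef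
  have hV : ∀ z ∈ U, ∀ a, ContDiffAt ℝ ∞ (V a) z := fun z hz => hF.contDiffAt_tension hz
  have hUy := hF.source.isOpen.eventually_mem hy
  have h1 : ∀ z ∈ U, ∀ j a, covAlong K F (fun a z => f z * V a z) j a z
      = pd j f z * V a z + f z * covAlong K F V j a z :=
    fun z hz j a => covAlong_mul (hf z hz) (hV z hz) j a
  have h2 : ∀ i j a, covAlong K F (covAlong K F (fun a z => f z * V a z) j) i a y
      = pd i (pd j f) y * V a y + pd j f y * covAlong K F V i a y
        + (pd i f y * covAlong K F V j a y + f y * covAlong K F (covAlong K F V j) i a y) := by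
    intro i j a
    have hc : ∀ a, ContDiffAt ℝ ∞ (covAlong K F V j a) y :=
      hF.contDiffAt_covAlong hy (hV y hy) j
    rw [covAlong_congr (W := fun a z => pd j f z * V a z + f z * covAlong K F V j a z)
      (fun a => hUy.mono fun z hz => h1 z hz j a),
      covAlong_add (fun a => (contDiffAt_pd (hf y hy) j).mul (hV y hy a))
        (fun a => (hf y hy).mul (hc a)),
      covAlong_mul (contDiffAt_pd (hf y hy) j) (hV y hy), covAlong_mul (hf y hy) hc]
  have hcurv : curvTrace G K F (fun a z => f z * V a z) a y = f y * curvTrace G K F V a y := by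
    simp only [curvTrace, Finset.mul_sum]
    iterate 5 refine Finset.sum_congr rfl fun _ _ => ?_
    ring
  have hgrad : ∑ i, ∑ j, (G y)⁻¹ i j * (pd j f y * covAlong K F V i a y)
      = ∑ i, grad G f i y * covAlong K F V i a y := by
    simp only [grad, Finset.sum_mul]
    exact Finset.sum_congr rfl fun i _ => Finset.sum_congr rfl fun j _ => by ring
  -- By symmetry of the inverse metric both cross terms of the product rule equal ∇_{grad f}τ,
  -- whence the coefficient 2 in the f-bitension field.
  have hgrad' : ∑ i, ∑ j, (G y)⁻¹ i j * (pd i f y * covAlong K F V j a y)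
      = ∑ i, grad G f i y * covAlong K F V i a y := by
    rw [← hgrad, Finset.sum_comm]
    exact Finset.sum_congr rfl fun i _ => Finset.sum_congr rfl fun j _ => by
      rw [hF.source.inv_symm hy]
  have hrough : roughLaplacian G K F (fun a z => f z * V a z) a y
      = f y * roughLaplacian G K F V a y + laplacian G f y * V a y
        + 2 * ∑ i, grad G f i y * covAlong K F V i a y := by
    rw [two_mul]
    nth_rw 1 [← hgrad]
    rw [← hgrad']
    simp only [roughLaplacian, laplacian, h2, h1 y hy, Finset.mul_sum, Finset.sum_mul,
      ← Finset.sum_add_distrib]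
    refine Finset.sum_congr rfl fun i _ => Finset.sum_congr rfl fun j _ => ?_
    have hs : ∑ k, christoffel G k i j y * (pd k f y * V a y + f y * covAlong K F V k a y)
        = (∑ k, christoffel G k i j y * pd k f y) * V a y
          + f y * ∑ k, christoffel G k i j y * covAlong K F V k a y := by
      rw [Finset.sum_mul, Finset.mul_sum, ← Finset.sum_add_distrib]
      exact Finset.sum_congr rfl fun k _ => by ring
    rw [hs]
    ring
  rw [hrough, hcurv]
  simp only [fBitension, bitension]
  ring

/-- At a local maximum of `|W|²`, `⟨ΔW, W⟩ + |∇W|² ≤ 0`. -/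
theorem form_roughLaplacian_add_nonpos (hy : y ∈ U) {W : Comps m n}
    (hW : ∀ z ∈ U, ∀ a, ContDiffAt ℝ ∞ (W a) z)
    (hmax : IsLocalMax (fun z => form (K (F z)) (val W z) (val W z)) y) :
    form (K (F y)) (val (roughLaplacian G K F W) y) (val W y)
      + ∑ i, ∑ j, (G y)⁻¹ i j *
        form (K (F y)) (val (covAlong K F W i) y) (val (covAlong K F W j) y) ≤ 0 := by
  set u : Eucl m → ℝ := fun z => form (K (F z)) (val W z) (val W z) with hu
  have hUy := hF.source.isOpen.eventually_mem hy
  have hsm : ContDiffAt ℝ ∞ u y :=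
    contDiffAt_form hF.target (hF.smooth y hy) (hF.mapsTo y hy) (hW y hy) (hW y hy)
  have h1 : ∀ z ∈ U, ∀ j, pd j u z
      = 2 * form (K (F z)) (val (covAlong K F W j) z) (val W z) := by
    intro z hz j
    rw [hu, hF.pd_form hz (hW z hz) (hW z hz), hF.form_comm hz (val W z)]
    ring
  have h2 : ∀ i j, pd i (pd j u) y
      = 2 * (form (K (F y)) (val (covAlong K F (covAlong K F W j) i) y) (val W y)
        + form (K (F y)) (val (covAlong K F W i) y) (val (covAlong K F W j) y)) := by
    intro i j
    have hc := hF.contDiffAt_covAlong hy (hW y hy) j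
    rw [pd_congr (hUy.mono fun z hz => h1 z hz j) i,
      pd_mul contDiffAt_const (contDiffAt_form hF.target (hF.smooth y hy) (hF.mapsTo y hy) hc
        (hW y hy)), pd_const, hF.pd_form hy hc (hW y hy),
      hF.form_comm hy (val (covAlong K F W j) y) (val (covAlong K F W i) y)]
    ring
  -- At a critical point of |W|² the Christoffel terms of the Laplacian drop out, so the trace of
  -- the coordinate Hessian suffices.
  have h0 : ∀ k, form (K (F y)) (val (covAlong K F W k) y) (val W y) = 0 := by
    intro k
    have := h1 y hy k
    rw [pd_eq_zero_of_isLocalMax hmax] at this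
    linarith
  have := trace_hess_nonpos_of_isLocalMax hsm hmax (hF.source.posDef y hy).inv.posSemidef
  have heq : ∑ i, ∑ j, (G y)⁻¹ i j * pd i (pd j u) y
      = 2 * (form (K (F y)) (val (roughLaplacian G K F W) y) (val W y)
      + ∑ i, ∑ j, (G y)⁻¹ i j *
        form (K (F y)) (val (covAlong K F W i) y) (val (covAlong K F W j) y)) := by
    rw [val_roughLaplacian]
    simp only [h2, map_sum, map_smul, map_sub, LinearMap.sum_apply, LinearMap.smul_apply,
      LinearMap.sub_apply, smul_eq_mul, h0, mul_zero, Finset.sum_const_zero, sub_zero,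
      ← Finset.sum_add_distrib, Finset.mul_sum]
    refine Finset.sum_congr rfl fun i _ => Finset.sum_congr rfl fun j _ => ?_
    ring
  linarith

/-- A normal field which is parallel at `y` is orthogonal to the tension field there. -/
theorem form_tension_eq_zero_of_covAlong_eq_zero (hy : y ∈ U) {W : Comps m n}
    (hW : ∀ z ∈ U, ∀ a, ContDiffAt ℝ ∞ (W a) z)
    (hnormal : ∀ z ∈ U, ∀ l, form (K (F z)) (val W z) (val (push F l) z) = 0)
    (hpar : ∀ i, val (covAlong K F W i) y = 0) :
    form (K (F y)) (val W y) (val (tension G K F) y) = 0 := by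
  have h : ∀ i j, form (K (F y)) (val W y) (val (covAlong K F (push F j) i) y) = 0 := by
    intro i j
    -- Differentiate ⟨W, dF ∂_j⟩ = 0 in the direction ∂_i; the term containing ∇_i W is zero by
    -- `hpar`.
    have h1 := hF.pd_form hy (hW y hy) (hF.contDiffAt_push hy j) i
    rw [pd_congr (v := fun _ => 0) ((hF.source.isOpen.eventually_mem hy).mono
      fun z hz => hnormal z hz j), pd_const, hpar] at h1
    simpa using h1.symm
  simp [val_tension, val_hess, h, hnormal y hy]

end IsLocalIsometry

end LocalIsometry

/-! ### Curvature of hypersurfaces of Einstein spaces -/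

section Curvature

variable {m n : ℕ}

/-- The entrywise partial derivative of a family of matrices. -/
def pdMatrix (i : Fin m) (A : Eucl m → Matrix (Fin n) (Fin n) ℝ) (z : Eucl m) :
    Matrix (Fin n) (Fin n) ℝ :=
  Matrix.of fun a b => pd i (fun z => A z a b) z

theorem pdMatrix_mul {A B : Eucl m → Matrix (Fin n) (Fin n) ℝ} {z : Eucl m}
    (hA : ∀ a b, ContDiffAt ℝ ∞ (fun z => A z a b) z)
    (hB : ∀ a b, ContDiffAt ℝ ∞ (fun z => B z a b) z) (i : Fin m) :
    pdMatrix i (fun z => A z * B z) z = pdMatrix i A z * B z + A z * pdMatrix i B z := by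
  ext a b
  simp only [pdMatrix, Matrix.of_apply, Matrix.mul_apply, Matrix.add_apply]
  rw [pd_sum _ fun c _ => (hA a c).mul (hB c b), ← Finset.sum_add_distrib]
  exact Finset.sum_congr rfl fun c _ => pd_mul (hA a c) (hB c b) i

theorem pdMatrix_add {A B : Eucl m → Matrix (Fin n) (Fin n) ℝ} {z : Eucl m}
    (hA : ∀ a b, ContDiffAt ℝ ∞ (fun z => A z a b) z)
    (hB : ∀ a b, ContDiffAt ℝ ∞ (fun z => B z a b) z) (i : Fin m) :
    pdMatrix i (fun z => A z + B z) z = pdMatrix i A z + pdMatrix i B z := by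
  ext a b
  exact pd_add (hA a b) (hB a b) i

/-- The matrix of `∇_{∂_i}` acting on coordinate vectors. -/
def christoffelMatrix (K : Eucl n → Matrix (Fin n) (Fin n) ℝ) (i : Fin n) (z : Eucl n) :
    Matrix (Fin n) (Fin n) ℝ :=
  Matrix.of fun l k => christoffel K l i k z

/-- The matrix of the curvature operator `R(∂_i, ∂_j)`. -/
def curvMatrix (K : Eucl n → Matrix (Fin n) (Fin n) ℝ) (i j : Fin n) (z : Eucl n) :
    Matrix (Fin n) (Fin n) ℝ :=
  Matrix.of fun l k => curv K l i j k z

/-- The structure equation R = dΓ + Γ∧Γ in matrix form; it reduces the skewness of R to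
noncommutative algebra. -/
theorem curvMatrix_eq (K : Eucl n → Matrix (Fin n) (Fin n) ℝ) (i j : Fin n) (z : Eucl n) :
    curvMatrix K i j z = pdMatrix i (christoffelMatrix K j) z - pdMatrix j (christoffelMatrix K i) z
      + (christoffelMatrix K i z * christoffelMatrix K j z
        - christoffelMatrix K j z * christoffelMatrix K i z) := by
  ext l k
  simp only [curvMatrix, curv, pdMatrix, christoffelMatrix, Matrix.of_apply, Matrix.add_apply,
    Matrix.sub_apply, Matrix.mul_apply, Finset.sum_sub_distrib]

namespace IsLocalMetric

variable {K : Eucl n → Matrix (Fin n) (Fin n) ℝ} {Ω : Set (Eucl n)} (hK : IsLocalMetric K Ω)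
  {z : Eucl n}

include hK

theorem pdMatrix_coeff (hz : z ∈ Ω) (i : Fin n) :
    pdMatrix i K z = (christoffelMatrix K i z).transpose * K z + K z * christoffelMatrix K i z := by
  ext b c
  simp only [pdMatrix, christoffelMatrix, Matrix.of_apply, Matrix.add_apply, Matrix.mul_apply,
    Matrix.transpose_apply]
  rw [hK.pd_coeff hz]
  congr 1
  exact Finset.sum_congr rfl fun s _ => mul_comm _ _

/-- The curvature operator is skew-adjoint. -/
theorem curvMatrix_skew (hz : z ∈ Ω) (i j : Fin n) :
    (curvMatrix K i j z).transpose * K z + K z * curvMatrix K i j z = 0 := by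
  have hA : ∀ i a b, ContDiffAt ℝ ∞ (fun z => christoffelMatrix K i z a b) z :=
    fun i a b => hK.contDiffAt_christoffel hz a i b
  have hmul : ∀ {A B : Eucl n → Matrix (Fin n) (Fin n) ℝ},
      (∀ a b, ContDiffAt ℝ ∞ (fun z => A z a b) z) →
      (∀ a b, ContDiffAt ℝ ∞ (fun z => B z a b) z) →
      ∀ a b, ContDiffAt ℝ ∞ (fun z => (A z * B z) a b) z := by
    intro A B hA hB a b
    simp only [Matrix.mul_apply]
    exact ContDiffAt.sum fun c _ => (hA a c).mul (hB c b)
  have h2 : ∀ i j, pdMatrix j (pdMatrix i K) z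
      = (pdMatrix j (christoffelMatrix K i) z).transpose * K z
        + (christoffelMatrix K i z).transpose * ((christoffelMatrix K j z).transpose * K z
          + K z * christoffelMatrix K j z)
        + (((christoffelMatrix K j z).transpose * K z + K z * christoffelMatrix K j z)
          * christoffelMatrix K i z + K z * pdMatrix j (christoffelMatrix K i) z) := by
    intro i j
    have hT : ∀ a b, ContDiffAt ℝ ∞ (fun z => (christoffelMatrix K i z).transpose a b) z :=
      fun a b => hA i b a
    have h3 : pdMatrix j (pdMatrix i K) z
        = pdMatrix j (fun z => (christoffelMatrix K i z).transpose * K z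
          + K z * christoffelMatrix K i z) z := by
      ext a b
      exact pd_congr ((hK.isOpen.eventually_mem hz).mono fun w hw => by
        rw [hK.pdMatrix_coeff hw]) j
    rw [h3, pdMatrix_add (hmul hT (hK.smooth z hz)) (hmul (hK.smooth z hz) (hA i)),
      pdMatrix_mul hT (hK.smooth z hz), pdMatrix_mul (hK.smooth z hz) (hA i),
      hK.pdMatrix_coeff hz]
    rfl
  -- The relation ∂_i K = Γ_iᵀK + KΓ_i has been differentiated once more. Equality of the mixed
  -- second derivatives of K is precisely the skewness of R.
  have hcomm : pdMatrix j (pdMatrix i K) z = pdMatrix i (pdMatrix j K) z := by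
    ext a b
    exact pd_comm (hK.smooth z hz a b) j i
  rw [h2, h2, ← sub_eq_zero] at hcomm
  rw [curvMatrix_eq, ← neg_eq_zero, ← hcomm]
  simp only [Matrix.transpose_add, Matrix.transpose_sub, Matrix.transpose_mul]
  noncomm_ring

theorem form_curvMatrix (hz : z ∈ Ω) (i j : Fin n) (v w : Fin n → ℝ) :
    form (K z) ((curvMatrix K i j z).mulVec v) w
      = -form (K z) v ((curvMatrix K i j z).mulVec w) := by
  have hform : ∀ v w, form (K z) v w = v ⬝ᵥ (K z).mulVec w := fun v w =>
    Matrix.toLinearMap₂'_apply' _ _ _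
  rw [← add_eq_zero_iff_eq_neg, hform, hform, Matrix.mulVec_mulVec, ← Matrix.vecMul_transpose,
    ← Matrix.dotProduct_mulVec, Matrix.mulVec_mulVec, ← dotProduct_add, ← Matrix.add_mulVec,
    hK.curvMatrix_skew hz]
  simp

/-- If `Ric = μ h` then the scalar curvature is `n μ`. -/
theorem scal_eq (hz : z ∈ Ω) {μ : ℝ} (hric : ∀ i j, ricci K i j z = μ * K z i j) :
    scal K z = n * μ := by
  have h : ∀ j, ∑ k, (K z)⁻¹ j k * K z j k = 1 := by
    intro j
    have := congrFun (congrFun (Matrix.nonsing_inv_mul (K z) (hK.det_ne_zero hz).isUnit) j) j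
    rw [Matrix.mul_apply, Matrix.one_apply_eq] at this
    rw [← this]
    exact Finset.sum_congr rfl fun k _ => by rw [hK.symm hz j k]
  have h2 : ∀ j, ∑ k, (K z)⁻¹ j k * ricci K j k z = μ := by
    intro j
    rw [← mul_one μ, ← h j, Finset.mul_sum]
    exact Finset.sum_congr rfl fun k _ => by rw [hric]; ring
  simp [scal, h2]

end IsLocalMetric

/-- A frame of a hyperplane, completed by a normal vector, resolves the inverse metric. -/
theorem sum_inv_mul_frame {A : Matrix (Fin (m + 1)) (Fin (m + 1)) ℝ} (hA : A.PosDef)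
    {G : Matrix (Fin m) (Fin m) ℝ} (hG : G.det ≠ 0) {p : Fin m → Fin (m + 1) → ℝ}
    (hp : ∀ i j, form A (p i) (p j) = G i j) {w : Fin (m + 1) → ℝ} (hw : w ≠ 0)
    (hwp : ∀ i, form A w (p i) = 0) (b c : Fin (m + 1)) :
    ∑ i, ∑ j, G⁻¹ i j * p i b * p j c = A⁻¹ b c - w b * w c / form A w w := by
  have hpw : ∀ i, form A (p i) w = 0 := fun i => by
    rw [form_comm (posDef_symm hA), hwp]
  set s := form A w w with hs
  have hs0 : s ≠ 0 := (form_self_pos hA hw).ne'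
  -- The columns of Q are the p_i and w. Its Gram matrix is block diagonal with blocks G and |w|²,
  -- and D is the inverse of that matrix.
  let Q : Matrix (Fin (m + 1)) (Fin m ⊕ Unit) ℝ :=
    Matrix.of fun b => Sum.elim (fun i => p i b) (fun _ => w b)
  let D : Matrix (Fin m ⊕ Unit) (Fin m ⊕ Unit) ℝ :=
    Matrix.fromBlocks G⁻¹ 0 0 (Matrix.of fun _ _ => s⁻¹)
  have hentry : ∀ x y : Fin (m + 1) → ℝ,
      ∑ c, (∑ b, x b * A b c) * y c = form A x y := by
    intro x y
    rw [form_apply, Finset.sum_comm]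
    refine Finset.sum_congr rfl fun c _ => ?_
    rw [Finset.sum_mul]
    exact Finset.sum_congr rfl fun b _ => by ring
  have hgram : Q.transpose * A * Q = Matrix.fromBlocks G 0 0 (Matrix.of fun _ _ => s) := by
    ext (i | i) (j | j) <;>
      simp [Q, Matrix.mul_apply, hentry, hp, hwp, hpw, ← hs]
  have hone : D * (Q.transpose * A) * Q = 1 := by
    rw [Matrix.mul_assoc, hgram, Matrix.fromBlocks_multiply, Matrix.nonsing_inv_mul _ hG.isUnit]
    ext (i | i) (j | j) <;> simp [Matrix.mul_apply, hs0, Matrix.one_apply]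
  have hone' : Q * D * Q.transpose * A = 1 := by
    rw [Matrix.mul_assoc, Matrix.mul_assoc]
    -- Codimension one enters here: Q is square, so a one-sided inverse is two-sided and Q D Qᵀ
    -- inverts A.
    exact (Matrix.mul_eq_one_comm_of_card_eq _ _ _ (by simp)).1 hone
  rw [Matrix.inv_eq_left_inv hone']
  simp only [Q, D, Matrix.mul_apply, Matrix.of_apply, Matrix.transpose_apply,
    Fintype.sum_sum_type, Sum.elim_inl, Sum.elim_inr, Matrix.fromBlocks_apply₁₁,
    Matrix.fromBlocks_apply₁₂, Matrix.fromBlocks_apply₂₁, Matrix.fromBlocks_apply₂₂]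
  simp only [Matrix.zero_apply, mul_zero, Finset.sum_const_zero, add_zero, zero_add,
    Finset.univ_unique, Finset.sum_singleton, Finset.sum_mul]
  rw [Finset.sum_comm]
  have : ∀ i j, p i b * G⁻¹ i j * p j c = G⁻¹ i j * p i b * p j c := fun i j => by ring
  simp only [this]
  field_simp
  ring

variable {G : Eucl m → Matrix (Fin m) (Fin m) ℝ} {U : Set (Eucl m)}
  {K : Eucl (m + 1) → Matrix (Fin (m + 1)) (Fin (m + 1)) ℝ} {Ω : Set (Eucl (m + 1))}
  {F : Eucl m → Eucl (m + 1)}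

namespace IsLocalIsometry

variable (hF : IsLocalIsometry G U K Ω F) {y : Eucl m}

include hF

/-- `⟨Trace_g R(dF, W) dF, W⟩ = -Ric(W, W)` for a normal field `W` along a hypersurface. -/
theorem form_curvTrace (hy : y ∈ U) {W : Comps m (m + 1)}
    (hW : ∀ l, form (K (F y)) (val W y) (val (push F l) y) = 0) :
    form (K (F y)) (val (curvTrace G K F W) y) (val W y)
      = -∑ c, ∑ d, ricci K c d (F y) * W c y * W d y := by
  -- The completed frame requires a nonzero normal vector; for W = 0 both sides vanish.
  by_cases h0 : val W y = 0
  · have : ∀ a, W a y = 0 := fun a => congrFun h0 a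
    simp [h0, this]
  set w := val W y with hw
  set p : Fin m → Fin (m + 1) → ℝ := fun i => val (push F i) y with hp
  set A := K (F y) with hA
  have hz := hF.mapsTo y hy
  set R := fun b c => curvMatrix K b c (F y) with hR
  have hval : val (curvTrace G K F W) y
      = ∑ i, ∑ j, (G y)⁻¹ i j • ∑ b, ∑ c, (p i b * w c) • (R b c).mulVec (p j) := by
    ext a
    simp only [val, curvTrace, hp, hw, hR, curvMatrix, Finset.sum_apply, Pi.smul_apply, smul_eq_mul,
      Matrix.mulVec, dotProduct, Matrix.of_apply, Finset.mul_sum]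
    iterate 5 refine Finset.sum_congr rfl fun _ _ => ?_
    ring
  -- Ψ b q is ⟨R(∂_b, W)W, ∂_q⟩. Its trace over the whole ambient space is Ric(W,W) (`h2`), and its
  -- normal part vanishes (`h3`), so the tangential trace is also Ric(W,W).
  let Ψ : Fin (m + 1) → Fin (m + 1) → ℝ := fun b q =>
    ∑ c, w c * A.mulVec ((R b c).mulVec w) q
  have hform : ∀ v x, form A v x = ∑ q, v q * A.mulVec x q := fun v x =>
    Matrix.toLinearMap₂'_apply' _ _ _
  have h1 : form A (val (curvTrace G K F W) y) w
      = -∑ b, ∑ q, (∑ i, ∑ j, (G y)⁻¹ i j * p i b * p j q) * Ψ b q := by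
    rw [hval]
    simp only [map_sum, map_smul, LinearMap.sum_apply, LinearMap.smul_apply, smul_eq_mul]
    simp only [hR, hA, hF.target.form_curvMatrix hz]
    simp only [← hA, hform, Ψ, Finset.mul_sum, Finset.sum_mul, mul_neg, Finset.sum_neg_distrib]
    congr 1
    have e1 : ∀ T : Fin m → Fin m → Fin (m + 1) → Fin (m + 1) → Fin (m + 1) → ℝ,
        ∑ i, ∑ j, ∑ b, ∑ c, ∑ q, T i j b c q = ∑ b, ∑ q, ∑ c, ∑ i, ∑ j, T i j b c q := by
      intro T
      conv_lhs => enter [2, i]; rw [Finset.sum_comm]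
      rw [Finset.sum_comm]
      refine Finset.sum_congr rfl fun b _ => ?_
      conv_lhs => enter [2, i, 2, j]; rw [Finset.sum_comm]
      conv_lhs => enter [2, i]; rw [Finset.sum_comm]
      rw [Finset.sum_comm]
      refine Finset.sum_congr rfl fun q _ => ?_
      conv_lhs => enter [2, i]; rw [Finset.sum_comm]
      rw [Finset.sum_comm]
    rw [e1]
    refine Finset.sum_congr rfl fun b _ => Finset.sum_congr rfl fun q _ =>
      Finset.sum_congr rfl fun c _ => Finset.sum_congr rfl fun i _ =>
      Finset.sum_congr rfl fun j _ => ?_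
    ring
  have hframe := sum_inv_mul_frame (hF.target.posDef _ hz) (hF.source.det_ne_zero hy)
    (hF.isometric y hy) h0 hW
  have h2 : ∑ b, ∑ q, A⁻¹ b q * Ψ b q = ∑ c, ∑ d, ricci K c d (F y) * W c y * W d y := by
    have e : ∀ b, ∑ q, A⁻¹ b q * Ψ b q = ∑ c, w c * (R b c).mulVec w b := by
      intro b
      simp only [Ψ, Finset.mul_sum]
      rw [Finset.sum_comm]
      refine Finset.sum_congr rfl fun c _ => ?_
      have := sum_inv_mul_sum_mul (hF.target.det_ne_zero hz) ((R b c).mulVec w) b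
      rw [← this, Finset.mul_sum]
      exact Finset.sum_congr rfl fun q _ => by
        simp only [Matrix.mulVec, dotProduct, ← hA]
        ring
    simp only [e]
    rw [Finset.sum_comm]
    refine Finset.sum_congr rfl fun c _ => ?_
    simp only [ricci, hR, curvMatrix, Matrix.mulVec, dotProduct, Matrix.of_apply, Finset.mul_sum,
      Finset.sum_mul]
    rw [Finset.sum_comm]
    refine Finset.sum_congr rfl fun d _ => Finset.sum_congr rfl fun b _ => ?_
    simp only [hw, val]
    ring
  have h3 : ∑ b, ∑ q, w b * w q / form A w w * Ψ b q = 0 := by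
    refine Finset.sum_eq_zero fun b _ => ?_
    -- ⟨W, R(∂_b, ∂_c)W⟩ = 0 because the curvature operator is skew-adjoint.
    have hzero : ∀ c, ∑ q, w q * A.mulVec ((R b c).mulVec w) q = 0 := by
      intro c
      rw [← hform]
      have h4 := hF.target.form_curvMatrix hz b c w w
      rw [RiemGeom.form_comm (hF.target.symm hz)] at h4
      simp only [hR, hA]
      linarith
    have e : ∑ q, w b * w q / form A w w * Ψ b q
        = ∑ c, w b * w c / form A w w * ∑ q, w q * A.mulVec ((R b c).mulVec w) q := by
      simp only [Ψ, Finset.mul_sum]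
      rw [Finset.sum_comm]
      exact Finset.sum_congr rfl fun c _ => Finset.sum_congr rfl fun q _ => by ring
    rw [e]
    exact Finset.sum_eq_zero fun c _ => by rw [hzero, mul_zero]
  rw [h1]
  have hframe' : ∀ b q, ∑ i, ∑ j, (G y)⁻¹ i j * p i b * p j q
      = A⁻¹ b q - w b * w q / form A w w := hframe
  simp only [hframe', sub_mul, Finset.sum_sub_distrib, h2, h3, sub_zero]

/-- Let `F` be an `f`-biharmonic hypersurface of an Einstein space of nonpositive scalar curvature.
Then the tension field vanishes wherever `|f τ|²` has a local maximum. -/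
theorem tension_eq_zero_of_isLocalMax {μ : ℝ} (hμ : μ ≤ 0) (hy : y ∈ U)
    (hric : ∀ i j, ricci K i j (F y) = μ * K (F y) i j) {f : Eucl m → ℝ}
    (hf : ∀ z ∈ U, ContDiffAt ℝ ∞ f z) (hpos : 0 < f y)
    (hbi : ∀ a, fBitension G K F f a y = 0)
    (hmax : IsLocalMax (fun z => f z ^ 2 *
      form (K (F z)) (val (tension G K F) z) (val (tension G K F) z)) y) :
    val (tension G K F) y = 0 := by
  set τ := tension G K F with hτ
  set W : Comps m (m + 1) := fun a z => f z * τ a z with hWdef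
  have hvalW : ∀ z, val W z = f z • val τ z := fun z => rfl
  have hW : ∀ z ∈ U, ∀ a, ContDiffAt ℝ ∞ (W a) z :=
    fun z hz a => (hf z hz).mul (hF.contDiffAt_tension hz a)
  have hnormal : ∀ z ∈ U, ∀ l, form (K (F z)) (val W z) (val (push F l) z) = 0 := by
    intro z hz l
    rw [hvalW, map_smul, LinearMap.smul_apply, hF.form_tension_push hz, smul_zero]
  have hmaxW : IsLocalMax (fun z => form (K (F z)) (val W z) (val W z)) y := by
    convert hmax using 2 with z
    simp only [hvalW, map_smul, LinearMap.smul_apply, smul_eq_mul]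
    ring
  have hle := hF.form_roughLaplacian_add_nonpos hy hW hmaxW
  have hjac : val (roughLaplacian G K F W) y = val (curvTrace G K F W) y := by
    ext a
    have := hF.fBitension_eq hy hf a
    rw [hbi] at this
    exact (sub_eq_zero.1 this.symm)
  have hcurv : form (K (F y)) (val (curvTrace G K F W) y) (val W y)
      = -μ * form (K (F y)) (val W y) (val W y) := by
    rw [hF.form_curvTrace hy (hnormal y hy), form_apply]
    simp only [hric, Finset.mul_sum, ← Finset.sum_neg_distrib]
    exact Finset.sum_congr rfl fun c _ => Finset.sum_congr rfl fun d _ => by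
      simp only [val]
      ring
  have hWW := form_self_nonneg (hF.target.posDef _ (hF.mapsTo y hy)) (val W y)
  rw [hjac, hcurv] at hle
  -- Now `hle` says -μ|W|² + |∇W|² ≤ 0, and the first term is nonnegative since μ ≤ 0; hence |∇W|² ≤
  -- 0.
  have hpar := eq_zero_of_sum_form_nonpos (hF.target.posDef _ (hF.mapsTo y hy))
    (hF.source.posDef y hy).inv (v := fun i => val (covAlong K F W i) y) (by nlinarith)
  have h0 := hF.form_tension_eq_zero_of_covAlong_eq_zero hy hW hnormal hpar
  rw [hvalW, map_smul, LinearMap.smul_apply, smul_eq_mul] at h0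
  refine eq_zero_of_form_self_nonpos (hF.target.posDef _ (hF.mapsTo y hy)) ?_
  rcases mul_eq_zero.1 h0 with h | h
  · exact absurd h hpos.ne'
  · exact h.le

end IsLocalIsometry

end Curvature

/-! ### Invariance of the tension field under isometric changes of coordinates -/

section Composition

variable {m n p : ℕ}

theorem push_congr {F F' : Eucl m → Eucl n} {y : Eucl m} (h : F =ᶠ[𝓝 y] F') (i : Fin m)
    (a : Fin n) : push F i a =ᶠ[𝓝 y] push F' i a :=
  pd_eventuallyEq (h.mono fun z hz => by rw [hz]) i

theorem tension_congr (G : Eucl m → Matrix (Fin m) (Fin m) ℝ)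
    (K : Eucl n → Matrix (Fin n) (Fin n) ℝ) {F F' : Eucl m → Eucl n} {y : Eucl m}
    (h : F =ᶠ[𝓝 y] F') : val (tension G K F) y = val (tension G K F') y := by
  ext a
  have h1 : ∀ i a, push F i a y = push F' i a y := fun i a => (push_congr h i a).eq_of_nhds
  have h2 : ∀ i j, pd i (push F j a) y = pd i (push F' j a) y :=
    fun i j => pd_congr (push_congr h j a) i
  simp only [val, tension, covAlong, h1, h2, h.eq_of_nhds]

/-- The squared norm of the tension field. -/
def tensionNormSq (G : Eucl m → Matrix (Fin m) (Fin m) ℝ)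
    (K : Eucl n → Matrix (Fin n) (Fin n) ℝ) (F : Eucl m → Eucl n) (y : Eucl m) : ℝ :=
  form (K (F y)) (val (tension G K F) y) (val (tension G K F) y)

theorem tensionNormSq_congr (G : Eucl m → Matrix (Fin m) (Fin m) ℝ)
    (K : Eucl n → Matrix (Fin n) (Fin n) ℝ) {F F' : Eucl m → Eucl n} {y : Eucl m}
    (h : F =ᶠ[𝓝 y] F') : tensionNormSq G K F y = tensionNormSq G K F' y := by
  simp only [tensionNormSq, tension_congr G K h, h.eq_of_nhds]

theorem push_comp {F : Eucl m → Eucl n} {Θ : Eucl n → Eucl p} {y : Eucl m}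
    (hF : ContDiffAt ℝ ∞ F y) (hΘ : ContDiffAt ℝ ∞ Θ (F y)) (i : Fin m) (a : Fin p) :
    push (fun z => Θ (F z)) i a y = ∑ b, push Θ b a (F y) * push F i b y :=
  pd_comp (contDiffAt_coord hΘ a) hF i

theorem sum_comm₃ {α β γ : Type*} [Fintype α] [Fintype β] [Fintype γ] (T : α → β → γ → ℝ) :
    ∑ i, ∑ j, ∑ k, T i j k = ∑ k, ∑ i, ∑ j, T i j k := by
  conv_lhs => enter [2, i]; rw [Finset.sum_comm]
  rw [Finset.sum_comm]

theorem sum_comm₄ {α β γ δ : Type*} [Fintype α] [Fintype β] [Fintype γ] [Fintype δ]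
    (T : α → β → γ → δ → ℝ) :
    ∑ i, ∑ j, ∑ k, ∑ l, T i j k l = ∑ k, ∑ l, ∑ i, ∑ j, T i j k l := by
  rw [sum_comm₃]
  exact Finset.sum_congr rfl fun k _ => sum_comm₃ _

/-- The second fundamental form of a composition. -/
theorem hess_comp (G : Eucl m → Matrix (Fin m) (Fin m) ℝ)
    (K : Eucl n → Matrix (Fin n) (Fin n) ℝ) (L : Eucl p → Matrix (Fin p) (Fin p) ℝ)
    {F : Eucl m → Eucl n} {Θ : Eucl n → Eucl p} {y : Eucl m}
    (hF : ∀ᶠ z in 𝓝 y, ContDiffAt ℝ ∞ F z) (hΘ : ∀ᶠ w in 𝓝 (F y), ContDiffAt ℝ ∞ Θ w)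
    (i j : Fin m) (a : Fin p) : hess G L (fun z => Θ (F z)) i j a y
      = ∑ b, push Θ b a (F y) * hess G K F i j b y
        + ∑ b, ∑ c, hess K L Θ b c a (F y) * push F i b y * push F j c y := by
  have hFy := hF.self_of_nhds
  have hΘy := hΘ.self_of_nhds
  have hpush : ∀ᶠ z in 𝓝 y, ∀ j a, push (fun z => Θ (F z)) j a z
      = ∑ b, push Θ b a (F z) * push F j b z := by
    filter_upwards [hF, hFy.continuousAt.eventually hΘ] with z h1 h2 j a
    exact push_comp h1 h2 j a
  have hpd : pd i (push (fun z => Θ (F z)) j a) y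
      = ∑ b, ∑ c, pd b (push Θ c a) (F y) * push F i b y * push F j c y
        + ∑ b, push Θ b a (F y) * pd i (push F j b) y := by
    have hsm : ∀ b, ContDiffAt ℝ ∞ (fun z => push Θ b a (F z)) y := fun b =>
      (contDiffAt_push hΘy b a).comp y hFy
    rw [pd_congr (hpush.mono fun z hz => hz j a) i,
      pd_sum _ fun b _ => (hsm b).mul (contDiffAt_push hFy j b)]
    rw [Finset.sum_comm, ← Finset.sum_add_distrib]
    refine Finset.sum_congr rfl fun b _ => ?_
    rw [pd_mul (hsm b) (contDiffAt_push hFy j b), pd_comp (contDiffAt_push hΘy b a) hFy,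
      Finset.sum_mul]
  have hp := hpush.self_of_nhds
  have hL : ∑ d, ∑ e, christoffel L a d e (Θ (F y)) * push (fun z => Θ (F z)) i d y
        * push (fun z => Θ (F z)) j e y
      = ∑ b, ∑ c, (∑ d, ∑ e, christoffel L a d e (Θ (F y)) * push Θ b d (F y) * push Θ c e (F y))
        * push F i b y * push F j c y := by
    simp only [hp, Finset.sum_mul, Finset.mul_sum]
    rw [sum_comm₄]
    conv_rhs => rw [Finset.sum_comm]
    refine Finset.sum_congr rfl fun _ _ => Finset.sum_congr rfl fun _ _ =>
      Finset.sum_congr rfl fun _ _ => Finset.sum_congr rfl fun _ _ => ?_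
    ring
  -- The Christoffel symbols of the intermediate metric K occur in both terms on the right with
  -- opposite signs, and cancel.
  have hK : ∑ b, ∑ c, (∑ k, christoffel K k b c (F y) * push Θ k a (F y))
        * push F i b y * push F j c y
      = ∑ b, push Θ b a (F y)
        * ∑ c, ∑ d, christoffel K b c d (F y) * push F i c y * push F j d y := by
    simp only [Finset.sum_mul, Finset.mul_sum]
    rw [sum_comm₃]
    refine Finset.sum_congr rfl fun _ _ => Finset.sum_congr rfl fun _ _ =>
      Finset.sum_congr rfl fun _ _ => ?_
    ring
  have hG : ∑ k, christoffel G k i j y * push (fun z => Θ (F z)) k a y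
      = ∑ b, push Θ b a (F y) * ∑ k, christoffel G k i j y * push F k b y := by
    simp only [hp, Finset.mul_sum]
    rw [Finset.sum_comm]
    exact Finset.sum_congr rfl fun _ _ => Finset.sum_congr rfl fun _ _ => by ring
  simp only [hess, covAlong]
  rw [hpd, hL, hG]
  simp only [add_mul, sub_mul, mul_add, mul_sub, Finset.sum_add_distrib, Finset.sum_sub_distrib]
  rw [hK]
  ring

end Composition

/-! ### Isometries of equal dimension and invariance of |τ|². -/

namespace IsLocalIsometry

variable {m n : ℕ} {G G' : Eucl m → Matrix (Fin m) (Fin m) ℝ} {U U' U₁ : Set (Eucl m)}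
  {K L : Eucl n → Matrix (Fin n) (Fin n) ℝ} {Ω Ω' Ω₁ : Set (Eucl n)}
  {F : Eucl m → Eucl n} {Θ : Eucl n → Eucl n} {ψ : Eucl m → Eucl m}

theorem eventually_smooth (hF : IsLocalIsometry G U K Ω F) {y : Eucl m} (hy : y ∈ U) :
    ∀ᶠ z in 𝓝 y, ContDiffAt ℝ ∞ F z :=
  (hF.source.isOpen.eventually_mem hy).mono hF.smooth

/-- The Jacobian matrix of an isometry transforms one Gram matrix into the other. -/
theorem jacobian_gram (hΘ : IsLocalIsometry K Ω L Ω' Θ) {z : Eucl n} (hz : z ∈ Ω) :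
    (Matrix.of fun a b => push Θ b a z).transpose * L (Θ z) * (Matrix.of fun a b => push Θ b a z)
      = K z := by
  ext i j
  rw [← hΘ.isometric z hz, form_apply, Finset.sum_comm]
  simp only [Matrix.mul_apply, Matrix.transpose_apply, Matrix.of_apply, Finset.sum_mul, val]
  exact Finset.sum_congr rfl fun _ _ => Finset.sum_congr rfl fun _ _ => by ring

theorem jacobian_det_ne_zero (hΘ : IsLocalIsometry K Ω L Ω' Θ) {z : Eucl n} (hz : z ∈ Ω) :
    (Matrix.of fun a b => push Θ b a z).det ≠ 0 := by
  intro h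
  apply hΘ.source.det_ne_zero hz
  rw [← hΘ.jacobian_gram hz, Matrix.det_mul, h, mul_zero]

/-- An isometry between domains of the same dimension is totally geodesic. -/
theorem hess_eq_zero (hΘ : IsLocalIsometry K Ω L Ω' Θ) {z : Eucl n} (hz : z ∈ Ω) (i j a : Fin n) :
    hess K L Θ i j a z = 0 := by
  have hdet := hΘ.jacobian_det_ne_zero hz
  have hL := hΘ.target.det_ne_zero (hΘ.mapsTo z hz)
  -- The Hessian is orthogonal to the image of dΘ, which is the whole space because the Jacobian is
  -- invertible.
  have h1 : (L (Θ z)).mulVec (val (hess K L Θ i j) z) = 0 := by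
    refine Matrix.eq_zero_of_mulVec_eq_zero
      (M := (Matrix.of fun a b => push Θ b a z).transpose) (by rwa [Matrix.det_transpose]) ?_
    ext l
    have h2 := hΘ.form_hess_push hz i j l
    rw [hΘ.form_comm hz, form, Matrix.toLinearMap₂'_apply'] at h2
    exact h2
  exact congrFun (Matrix.eq_zero_of_mulVec_eq_zero hL h1) a

/-- As ∇dΘ = 0, the composition formula gives τ(Θ∘F) = dΘ(τ(F)), and dΘ preserves lengths. -/
theorem tensionNormSq_comp_left (hF : IsLocalIsometry G U K Ω F)
    (hΘ : IsLocalIsometry K Ω₁ L Ω' Θ) {y : Eucl m} (hy : y ∈ U) (hFy : F y ∈ Ω₁) :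
    tensionNormSq G L (fun z => Θ (F z)) y = tensionNormSq G K F y := by
  have hval : val (tension G L (fun z => Θ (F z))) y
      = ∑ b, val (tension G K F) y b • val (push Θ b) (F y) := by
    ext a
    rw [val_tension, val_tension]
    simp only [Finset.sum_apply, Pi.smul_apply, smul_eq_mul, val,
      hess_comp G K L (hF.eventually_smooth hy) (hΘ.eventually_smooth hFy),
      hΘ.hess_eq_zero hFy, zero_mul, Finset.sum_const_zero, add_zero, Finset.sum_mul,
      Finset.mul_sum]
    rw [sum_comm₃]
    exact Finset.sum_congr rfl fun _ _ => Finset.sum_congr rfl fun _ _ =>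
      Finset.sum_congr rfl fun _ _ => by ring
  simp only [tensionNormSq, hval, map_sum, map_smul, LinearMap.sum_apply, LinearMap.smul_apply,
    smul_eq_mul, hΘ.isometric _ hFy]
  rw [form_apply]
  simp only [Finset.mul_sum]
  rw [Finset.sum_comm]
  exact Finset.sum_congr rfl fun b _ => Finset.sum_congr rfl fun c _ => by ring

/-- As ∇dψ = 0, only the Hessian of F evaluated on dψ survives, and dψ carries the inverse metric of
G' to that of G. The tension vectors themselves agree. -/
theorem tensionNormSq_comp_right (hF : IsLocalIsometry G U K Ω F)
    (hψ : IsLocalIsometry G' U' G U₁ ψ) {y : Eucl m} (hy : y ∈ U') (hψy : ψ y ∈ U) :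
    tensionNormSq G' K (fun z => F (ψ z)) y = tensionNormSq G K F (ψ y) := by
  have hinv : ∀ b c, ∑ i, ∑ j, (G' y)⁻¹ i j * push ψ i b y * push ψ j c y = (G (ψ y))⁻¹ b c := by
    intro b c
    set Q : Matrix (Fin m) (Fin m) ℝ := Matrix.of fun a b => push ψ b a y with hQ
    have hdet : IsUnit Q.det := (hψ.jacobian_det_ne_zero hy).isUnit
    have h1 : (G (ψ y))⁻¹ = Q * (G' y)⁻¹ * Q.transpose := by
      rw [← hψ.jacobian_gram hy, ← hQ, Matrix.mul_inv_rev, Matrix.mul_inv_rev, ← Matrix.mul_assoc,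
        Matrix.mul_nonsing_inv _ hdet, Matrix.one_mul, Matrix.mul_assoc,
        Matrix.nonsing_inv_mul _ (by rwa [Matrix.det_transpose]), Matrix.mul_one]
    rw [h1]
    simp only [Matrix.mul_apply, Matrix.transpose_apply, hQ, Matrix.of_apply, Finset.sum_mul]
    rw [Finset.sum_comm]
    exact Finset.sum_congr rfl fun _ _ => Finset.sum_congr rfl fun _ _ => by ring
  have hval : val (tension G' K (fun z => F (ψ z))) y = val (tension G K F) (ψ y) := by
    ext a
    rw [val_tension, val_tension]
    simp only [Finset.sum_apply, Pi.smul_apply, smul_eq_mul, val,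
      hess_comp G' G K (hψ.eventually_smooth hy) (hF.eventually_smooth hψy),
      hψ.hess_eq_zero hy, mul_zero, Finset.sum_const_zero, zero_add, ← hinv, Finset.sum_mul,
      Finset.mul_sum]
    rw [sum_comm₄]
    exact Finset.sum_congr rfl fun _ _ => Finset.sum_congr rfl fun _ _ =>
      Finset.sum_congr rfl fun _ _ => Finset.sum_congr rfl fun _ _ => by ring
  simp only [tensionNormSq, hval]

end IsLocalIsometry

/-! ### From manifolds to coordinate domains -/

section Manifolds

variable {m n : ℕ} {M : Type*} [TopologicalSpace M] [ChartedSpace (Eucl m) M]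
  [IsManifold (𝓡 m) ∞ M] {N : Type*} [TopologicalSpace N] [ChartedSpace (Eucl n) N]
  [IsManifold (𝓡 n) ∞ N]

/-- Needed because `d.symm (d (φ x))` equals φ x only propositionally, while the metric depends on
the base point; the tangent vectors live in the common model space. -/
theorem inner_congr_base (g : Metric m M) {x x' : M} (h : x = x') (u v : Eucl m) :
    g.inner x (u : TangentSpace (𝓡 m) x) (v : TangentSpace (𝓡 m) x)
      = g.inner x' (u : TangentSpace (𝓡 m) x') (v : TangentSpace (𝓡 m) x') := by
  subst h
  rfl

omit [IsManifold (𝓡 m) ∞ M] in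
theorem mdifferentiableAt_symm {c : OpenPartialHomeomorph M (Eucl m)}
    (hc : c ∈ IsManifold.maximalAtlas (𝓡 m) ∞ M) {y : Eucl m} (hy : y ∈ c.target) :
    MDifferentiableAt (𝓡 m) (𝓡 m) c.symm y :=
  (contMDiffAt_symm_of_mem_maximalAtlas hc hy).mdifferentiableAt (by simp)

/-- The coordinate field is the image of a constant section under the tangent map of `c.symm`, which
is smooth. -/
theorem contMDiffAt_coordVec {c : OpenPartialHomeomorph M (Eucl m)}
    (hc : c ∈ IsManifold.maximalAtlas (𝓡 m) ∞ M) {y : Eucl m} (hy : y ∈ c.target) (i : Fin m) :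
    ContMDiffAt (𝓡 m) (𝓡 m).tangent ∞
      (fun z => (⟨c.symm z, coordVec c i z⟩ : TangentBundle (𝓡 m) M)) y := by
  have h1 := (contMDiffOn_symm_of_mem_maximalAtlas hc).contMDiffOn_tangentMapWithin
    (m := ∞) (n := ∞) (by simp) c.open_target.uniqueMDiffOn
  have h2 : ContMDiffAt (𝓡 m) (𝓡 m).tangent ∞
      (fun z : Eucl m => (⟨z, (EuclideanSpace.single i 1 : Eucl m)⟩ : TangentBundle (𝓡 m) (Eucl m)))
      y := by
    exact contMDiffAt_vectorSpace_iff_contDiffAt.2 contDiffAt_const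
  have h3 : ContMDiffAt (𝓡 m).tangent (𝓡 m).tangent ∞
      (tangentMapWithin (𝓡 m) (𝓡 m) c.symm c.target)
      (⟨y, (EuclideanSpace.single i 1 : Eucl m)⟩ : TangentBundle (𝓡 m) (Eucl m)) := by
    refine h1.contMDiffAt ?_
    exact (c.open_target.preimage (FiberBundle.continuous_proj _ _)).mem_nhds hy
  refine (h3.comp y h2).congr_of_eventuallyEq ?_
  filter_upwards [c.open_target.mem_nhds hy] with z hz
  simp only [Function.comp, tangentMapWithin]
  rw [mfderivWithin_of_isOpen c.open_target hz]
  rfl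

theorem contDiffAt_coeff (g : Metric m M) {c : OpenPartialHomeomorph M (Eucl m)}
    (hc : c ∈ IsManifold.maximalAtlas (𝓡 m) ∞ M) {y : Eucl m} (hy : y ∈ c.target) (i j : Fin m) :
    ContDiffAt ℝ ∞ (fun z => coeff g c z i j) y := by
  -- With g installed as the bundle's inner product, smoothness of g(∂_i, ∂_j) is smoothness of an
  -- inner product of smooth sections.
  let _ : Bundle.RiemannianBundle (fun x : M => TangentSpace (𝓡 m) x) := ⟨g.toRiemannianMetric⟩
  have := (contMDiffAt_coordVec hc hy i).inner_bundle (contMDiffAt_coordVec hc hy j)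
  exact this.contDiffAt

omit [IsManifold (𝓡 m) ∞ M] in
theorem mfderiv_symm_injective {c : OpenPartialHomeomorph M (Eucl m)}
    (hc : c ∈ IsManifold.maximalAtlas (𝓡 m) ∞ M) {y : Eucl m} (hy : y ∈ c.target) {v : Eucl m}
    (hv : mfderiv (𝓡 m) (𝓡 m) c.symm y v = 0) : v = 0 := by
  have h1 : MDifferentiableAt (𝓡 m) (𝓡 m) c (c.symm y) :=
    (contMDiffAt_of_mem_maximalAtlas hc (c.map_target hy)).mdifferentiableAt (by simp)
  have h2 := mfderiv_comp_apply y h1 (mdifferentiableAt_symm hc hy) v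
  have h3 : c ∘ c.symm =ᶠ[𝓝 y] id :=
    (c.open_target.eventually_mem hy).mono fun z hz => c.right_inv hz
  rw [h3.mfderiv_eq, hv, map_zero, mfderiv_id] at h2
  exact h2

omit [IsManifold (𝓡 m) ∞ M] in
theorem mfderiv_symm_apply (c : OpenPartialHomeomorph M (Eucl m)) (y v : Eucl m) :
    mfderiv (𝓡 m) (𝓡 m) c.symm y v = ∑ i, v i • coordVec c i y := by
  conv_lhs => rw [sum_smul_single v]
  exact (map_sum (mfderiv (𝓡 m) (𝓡 m) c.symm y) _ _).trans
    (Finset.sum_congr rfl fun i _ => map_smul (mfderiv (𝓡 m) (𝓡 m) c.symm y) _ _)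

theorem form_coeff (g : Metric m M) (c : OpenPartialHomeomorph M (Eucl m)) (y v w : Eucl m) :
    form (coeff g c y) v w = g.inner (c.symm y) (mfderiv (𝓡 m) (𝓡 m) c.symm y v)
      (mfderiv (𝓡 m) (𝓡 m) c.symm y w) := by
  rw [mfderiv_symm_apply, mfderiv_symm_apply, form_apply]
  simp only [map_sum, map_smul, _root_.sum_apply, _root_.smul_apply,
    smul_eq_mul, Finset.mul_sum]
  rw [Finset.sum_comm]
  refine Finset.sum_congr rfl fun i _ => Finset.sum_congr rfl fun j _ => ?_
  simp only [coeff, Matrix.of_apply]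
  ring

theorem isLocalMetric_coeff (g : Metric m M) {c : OpenPartialHomeomorph M (Eucl m)}
    (hc : c ∈ IsManifold.maximalAtlas (𝓡 m) ∞ M) : IsLocalMetric (coeff g c) c.target where
  isOpen := c.open_target
  smooth _ hz i j := contDiffAt_coeff g hc hz i j
  posDef z hz := by
    refine Matrix.PosDef.of_dotProduct_mulVec_pos ?_ fun v hv => ?_
    · ext i j
      exact g.symm _ _ _
    · have h1 : star v ⬝ᵥ (coeff g c z).mulVec v = form (coeff g c z) v v :=
        (Matrix.toLinearMap₂'_apply' _ _ _).symm
      rw [h1]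
      have h2 := form_coeff g c z (WithLp.toLp 2 v) (WithLp.toLp 2 v)
      have h3 := g.pos (c.symm z) (mfderiv (𝓡 m) (𝓡 m) c.symm z (WithLp.toLp 2 v)) fun h0 =>
        hv (congrArg WithLp.ofLp (mfderiv_symm_injective hc hz h0))
      rw [← h2] at h3
      exact h3

/-- The domain of the expression of `φ` in the charts `c` and `d`. -/
def localDomain (φ : M → N) (c : OpenPartialHomeomorph M (Eucl m))
    (d : OpenPartialHomeomorph N (Eucl n)) : Set (Eucl m) :=
  {y | y ∈ c.target ∧ φ (c.symm y) ∈ d.source}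

omit [ChartedSpace (Eucl m) M] [IsManifold (𝓡 m) ∞ M] [ChartedSpace (Eucl n) N]
  [IsManifold (𝓡 n) ∞ N] in
theorem isOpen_localDomain {φ : M → N} (hφ : Continuous φ) (c : OpenPartialHomeomorph M (Eucl m))
    (d : OpenPartialHomeomorph N (Eucl n)) : IsOpen (localDomain φ c d) :=
  c.isOpen_inter_preimage_symm (d.open_source.preimage hφ)

omit [IsManifold (𝓡 m) ∞ M] [IsManifold (𝓡 n) ∞ N] in
theorem contDiffAt_localRep {φ : M → N} (hφ : ContMDiff (𝓡 m) (𝓡 n) ∞ φ)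
    {c : OpenPartialHomeomorph M (Eucl m)} {d : OpenPartialHomeomorph N (Eucl n)}
    (hc : c ∈ IsManifold.maximalAtlas (𝓡 m) ∞ M) (hd : d ∈ IsManifold.maximalAtlas (𝓡 n) ∞ N)
    {y : Eucl m} (hy : y ∈ localDomain φ c d) : ContDiffAt ℝ ∞ (localRep φ c d) y := by
  have h1 : ContMDiffAt (𝓡 m) (𝓡 n) ∞ (fun z => φ (c.symm z)) y :=
    hφ.contMDiffAt.comp y (contMDiffAt_symm_of_mem_maximalAtlas hc hy.1)
  exact ((contMDiffAt_of_mem_maximalAtlas hd hy.2).comp y h1).contDiffAt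

-- The chain rule for `d.symm ∘ localRep φ c d = φ ∘ c.symm` near y: the components `push` represent
-- dφ(∂_i) in the chart d.
omit [IsManifold (𝓡 m) ∞ M] [IsManifold (𝓡 n) ∞ N] in
theorem mfderiv_symm_push {φ : M → N} (hφ : ContMDiff (𝓡 m) (𝓡 n) ∞ φ)
    {c : OpenPartialHomeomorph M (Eucl m)} {d : OpenPartialHomeomorph N (Eucl n)}
    (hc : c ∈ IsManifold.maximalAtlas (𝓡 m) ∞ M) (hd : d ∈ IsManifold.maximalAtlas (𝓡 n) ∞ N)
    {y : Eucl m} (hy : y ∈ localDomain φ c d) (i : Fin m) :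
    (mfderiv (𝓡 n) (𝓡 n) d.symm (localRep φ c d y)
        (WithLp.toLp 2 (val (push (localRep φ c d) i) y)) : Eucl n)
      = mfderiv (𝓡 m) (𝓡 n) φ (c.symm y) (coordVec c i y) := by
  have hF := contDiffAt_localRep hφ hc hd hy
  have hpush : (WithLp.toLp 2 (val (push (localRep φ c d) i) y) : Eucl n)
      = mfderiv (𝓡 m) (𝓡 n) (localRep φ c d) y (EuclideanSpace.single i 1 : Eucl m) := by
    rw [mfderiv_eq_fderiv]
    ext a
    exact (fderiv_apply_coord hF _ a).symm
  have hFy : localRep φ c d y ∈ d.target := d.map_source hy.2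
  have h1 := mfderiv_comp_apply y (mdifferentiableAt_symm hd hFy)
    ((hF.differentiableAt (by simp)).mdifferentiableAt) (EuclideanSpace.single i 1 : Eucl m)
  have h2 := mfderiv_comp_apply y (hφ.mdifferentiableAt (by simp))
    (mdifferentiableAt_symm hc hy.1) (EuclideanSpace.single i 1 : Eucl m)
  have h3 : d.symm ∘ localRep φ c d =ᶠ[𝓝 y] φ ∘ c.symm :=
    ((isOpen_localDomain hφ.continuous c d).eventually_mem hy).mono fun z hz => d.left_inv hz.2
  rw [hpush]
  refine Eq.trans h1.symm (Eq.trans ?_ h2)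
  rw [h3.mfderiv_eq]
  rfl

/-- The coordinate expression of an isometric immersion is an isometric immersion. -/
theorem IsIsometricImmersion.isLocalIsometry {g : Metric m M} {h : Metric n N} {φ : M → N}
    (hφ : IsIsometricImmersion g h φ)
    {c : OpenPartialHomeomorph M (Eucl m)} {d : OpenPartialHomeomorph N (Eucl n)}
    (hc : c ∈ IsManifold.maximalAtlas (𝓡 m) ∞ M) (hd : d ∈ IsManifold.maximalAtlas (𝓡 n) ∞ N) :
    IsLocalIsometry (coeff g c) (localDomain φ c d) (coeff h d) d.target (localRep φ c d) where
  source :=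
    { isOpen := isOpen_localDomain hφ.smooth.continuous c d
      smooth := fun z hz => (isLocalMetric_coeff g hc).smooth z hz.1
      posDef := fun z hz => (isLocalMetric_coeff g hc).posDef z hz.1 }
  target := isLocalMetric_coeff h hd
  mapsTo y hy := d.map_source hy.2
  smooth y hy := contDiffAt_localRep hφ.smooth hc hd hy
  isometric y hy i j := by
    refine (form_coeff h d _ (WithLp.toLp 2 (val (push (localRep φ c d) i) y))
      (WithLp.toLp 2 (val (push (localRep φ c d) j) y))).trans ?_
    refine (inner_congr_base h (d.left_inv hy.2) _ _).trans ?_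
    rw [mfderiv_symm_push hφ.smooth hc hd hy, mfderiv_symm_push hφ.smooth hc hd hy]
    exact hφ.isometric _ _ _

/-- The coordinate expressions of the identity are the transition maps, so these become local
isometries of the coefficient metrics. -/
theorem isIsometricImmersion_id (g : Metric m M) : IsIsometricImmersion g g id where
  smooth := contMDiff_id
  isometric x u v := by
    rw [mfderiv_id]
    rfl

/-- Two chart expressions of φ differ by a transition map on each side; both are isometries, so the
two composition lemmas apply through the mixed expression in c' and d. -/
theorem tensionNormSq_eq {g : Metric m M} {h : Metric n N} {φ : M → N}
    (hφ : IsIsometricImmersion g h φ)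
    {c c' : OpenPartialHomeomorph M (Eucl m)} {d d' : OpenPartialHomeomorph N (Eucl n)}
    (hc : c ∈ IsManifold.maximalAtlas (𝓡 m) ∞ M) (hc' : c' ∈ IsManifold.maximalAtlas (𝓡 m) ∞ M)
    (hd : d ∈ IsManifold.maximalAtlas (𝓡 n) ∞ N) (hd' : d' ∈ IsManifold.maximalAtlas (𝓡 n) ∞ N)
    {x : M} (hxc : x ∈ c.source) (hxc' : x ∈ c'.source) (hxd : φ x ∈ d.source)
    (hxd' : φ x ∈ d'.source) :
    tensionNormSq (coeff g c') (coeff h d') (localRep φ c' d') (c' x)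
      = tensionNormSq (coeff g c) (coeff h d) (localRep φ c d) (c x) := by
  have hy' : c' x ∈ localDomain φ c' d := ⟨c'.map_source hxc', by rwa [c'.left_inv hxc']⟩
  have hy : c x ∈ localDomain φ c d := ⟨c.map_source hxc, by rwa [c.left_inv hxc]⟩
  have hψ := (isIsometricImmersion_id g).isLocalIsometry hc' hc
  have hψx : localRep id c' c (c' x) = c x := by simp [localRep, c'.left_inv hxc']
  have hyψ : c' x ∈ localDomain id c' c := ⟨c'.map_source hxc', by simpa [c'.left_inv hxc']⟩
  have hΘ := (isIsometricImmersion_id h).isLocalIsometry hd hd'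
  have hFx : localRep φ c' d (c' x) = d (φ x) := by simp [localRep, c'.left_inv hxc']
  have h1 := (hφ.isLocalIsometry hc' hd).tensionNormSq_comp_left hΘ hy'
    (by rw [hFx]; exact ⟨d.map_source hxd, by simpa [d.left_inv hxd]⟩)
  have h2 := (hφ.isLocalIsometry hc hd).tensionNormSq_comp_right hψ hyψ (by rwa [hψx])
  rw [hψx] at h2
  rw [← h2]
  have e1 : (fun z => localRep id d d' (localRep φ c' d z)) =ᶠ[𝓝 (c' x)] localRep φ c' d' :=
    ((isOpen_localDomain hφ.smooth.continuous c' d).eventually_mem hy').mono fun z hz => by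
      simp [localRep, d.left_inv hz.2]
  have e2 : (fun z => localRep φ c d (localRep id c' c z)) =ᶠ[𝓝 (c' x)] localRep φ c' d :=
    ((isOpen_localDomain continuous_id c' c).eventually_mem hyψ).mono fun z hz => by
      have : c'.symm z ∈ c.source := hz.2
      simp [localRep, c.left_inv this]
  rw [tensionNormSq_congr _ _ e2, ← h1, tensionNormSq_congr _ _ e1]

end Manifolds

/-! ### `f`-biharmonic hypersurfaces of Einstein manifolds -/

section Hypersurface

variable {m n : ℕ} {M : Type*} [TopologicalSpace M] [ChartedSpace (Eucl m) M]
  [IsManifold (𝓡 m) ∞ M] {N : Type*} [TopologicalSpace N] [ChartedSpace (Eucl n) N]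
  [IsManifold (𝓡 n) ∞ N]

/-- The function `|f τ(φ)|²` on `M`. -/
def weightedTensionNormSq (g : Metric m M) (h : Metric n N) (f : M → ℝ) (φ : M → N) (x : M) : ℝ :=
  f x ^ 2 * tensionNormSq (coeff g (chartAt (Eucl m) x)) (coeff h (chartAt (Eucl n) (φ x)))
    (localRep φ (chartAt (Eucl m) x) (chartAt (Eucl n) (φ x))) (chartAt (Eucl m) x x)

variable {g : Metric m M} {h : Metric n N} {φ : M → N}

theorem weightedTensionNormSq_eq (hφ : IsIsometricImmersion g h φ) (f : M → ℝ)
    {c : OpenPartialHomeomorph M (Eucl m)} {d : OpenPartialHomeomorph N (Eucl n)}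
    (hc : c ∈ IsManifold.maximalAtlas (𝓡 m) ∞ M) (hd : d ∈ IsManifold.maximalAtlas (𝓡 n) ∞ N)
    {x : M} (hxc : x ∈ c.source) (hxd : φ x ∈ d.source) : weightedTensionNormSq g h f φ x
      = f x ^ 2 * tensionNormSq (coeff g c) (coeff h d) (localRep φ c d) (c x) := by
  rw [weightedTensionNormSq, tensionNormSq_eq hφ hc (IsManifold.chart_mem_maximalAtlas x) hd
    (IsManifold.chart_mem_maximalAtlas (φ x)) hxc (mem_chart_source _ x) hxd
    (mem_chart_source _ (φ x))]

/-- The definition uses charts that change with the point. Chart independence lets one pair of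
charts serve a whole neighbourhood, where the expression is visibly continuous. -/
theorem continuous_weightedTensionNormSq (hφ : IsIsometricImmersion g h φ) {f : M → ℝ}
    (hf : Continuous f) : Continuous (weightedTensionNormSq g h f φ) := by
  rw [continuous_iff_continuousAt]
  intro x
  set c := chartAt (Eucl m) x with hcdef
  set d := chartAt (Eucl n) (φ x) with hddef
  have hc : c ∈ IsManifold.maximalAtlas (𝓡 m) ∞ M := IsManifold.chart_mem_maximalAtlas x
  have hd : d ∈ IsManifold.maximalAtlas (𝓡 n) ∞ N := IsManifold.chart_mem_maximalAtlas (φ x)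
  have hxc : x ∈ c.source := mem_chart_source _ x
  have hxd : φ x ∈ d.source := mem_chart_source _ (φ x)
  have hF := hφ.isLocalIsometry hc hd
  have hy : c x ∈ localDomain φ c d := ⟨c.map_source hxc, by rwa [c.left_inv hxc]⟩
  have h1 : ContinuousAt (tensionNormSq (coeff g c) (coeff h d) (localRep φ c d)) (c x) :=
    (contDiffAt_form hF.target (hF.smooth _ hy) (hF.mapsTo _ hy) (hF.contDiffAt_tension hy)
      (hF.contDiffAt_tension hy)).continuousAt
  have h2 : ContinuousAt (fun x => f x ^ 2 *
      tensionNormSq (coeff g c) (coeff h d) (localRep φ c d) (c x)) x :=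
    (hf.continuousAt.pow 2).mul (ContinuousAt.comp (f := c)
      (g := tensionNormSq (coeff g c) (coeff h d) (localRep φ c d)) h1 (c.continuousAt hxc))
  refine h2.congr ?_
  filter_upwards [c.open_source.mem_nhds hxc,
    (d.open_source.preimage hφ.smooth.continuous).mem_nhds hxd] with z hzc hzd
  exact (weightedTensionNormSq_eq hφ f hc hd hzc hzd).symm

/-- An isometric immersion is minimal if and only if its tension field vanishes. -/
theorem isMinimal_iff_tension_eq_zero (hφ : IsIsometricImmersion g h φ) :
    IsMinimal g h φ ↔ ∀ c ∈ IsManifold.maximalAtlas (𝓡 m) ∞ M,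
      ∀ d ∈ IsManifold.maximalAtlas (𝓡 n) ∞ N, ∀ y ∈ localDomain φ c d,
        ∀ a, tension (coeff g c) (coeff h d) (localRep φ c d) a y = 0 := by
  constructor
  · intro hmin c hc d hd y hy a
    have h1 := hmin c hc d hd y hy.1 hy.2 a
    rw [(hφ.isLocalIsometry hc hd).meanCurv_eq hy] at h1
    -- For m = 0 the factor 1/m is 0 and minimality carries no information, but the tension field is
    -- then an empty sum.
    rcases Nat.eq_zero_or_pos m with rfl | hm
    · simp [tension]
    · have : (m : ℝ) ≠ 0 := by positivity
      simpa [this] using h1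
  · intro hτ c hc d hd y hy hyd a
    rw [(hφ.isLocalIsometry hc hd).meanCurv_eq ⟨hy, hyd⟩, hτ c hc d hd y ⟨hy, hyd⟩, mul_zero]

/-- Vanishing on a neighbourhood is assumed because two covariant derivatives of τ occur. -/
theorem fBitension_eq_zero {G : Eucl m → Matrix (Fin m) (Fin m) ℝ}
    {K : Eucl n → Matrix (Fin n) (Fin n) ℝ} {F : Eucl m → Eucl n} {y : Eucl m}
    (hτ : ∀ a, tension G K F a =ᶠ[𝓝 y] fun _ => 0) (f : Eucl m → ℝ) (a : Fin n) :
    fBitension G K F f a y = 0 := by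
  have h0 : ∀ a, tension G K F a y = 0 := fun a => (hτ a).eq_of_nhds
  have h1 : ∀ i a, covAlong K F (tension G K F) i a =ᶠ[𝓝 y] fun _ => 0 := fun i a =>
    (covAlong_eventuallyEq (W := fun _ _ => 0) hτ i a).trans
      (Eventually.of_forall fun z => covAlong_zero i a z)
  have h2 : ∀ i a, covAlong K F (tension G K F) i a y = 0 := fun i a => (h1 i a).eq_of_nhds
  have h3 : ∀ i j a, covAlong K F (covAlong K F (tension G K F) j) i a y = 0 := fun i j a =>
    (covAlong_congr (W := fun _ _ => 0) (h1 j) i a).trans (covAlong_zero i a y)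
  simp [fBitension, bitension, roughLaplacian, curvTrace, h0, h2, h3]

theorem IsMinimal.isFBiharmonicMap (hφ : IsIsometricImmersion g h φ) (hmin : IsMinimal g h φ)
    (f : M → ℝ) : IsFBiharmonicMap g h f φ := by
  intro c hc d hd y hy hyd a
  have hτ := (isMinimal_iff_tension_eq_zero hφ).1 hmin c hc d hd
  exact fBitension_eq_zero (fun a =>
    ((isOpen_localDomain hφ.smooth.continuous c d).eventually_mem ⟨hy, hyd⟩).mono
      fun z hz => hτ z hz a) _ a

end Hypersurface

/-! ### The maximum principle on the compact hypersurface. -/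

section Einstein

variable {m : ℕ} {M : Type*} [TopologicalSpace M] [CompactSpace M] [ChartedSpace (Eucl m) M]
  [IsManifold (𝓡 m) ∞ M] {N : Type*} [TopologicalSpace N] [ChartedSpace (Eucl (m + 1)) N]
  [IsManifold (𝓡 (m + 1)) ∞ N] {g : Metric m M} {h : Metric (m + 1) N} {φ : M → N}

/-- A compact `f`-biharmonic hypersurface of an Einstein manifold of nonpositive scalar curvature
is minimal. -/
theorem IsFBiharmonicMap.isMinimal (hEinstein : IsEinstein h) (hscal : NonposScal h)
    (hφ : IsIsometricImmersion g h φ) {f : M → ℝ} (hf : ContMDiff (𝓡 m) 𝓘(ℝ, ℝ) ∞ f)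
    (hpos : ∀ x, 0 < f x) (hbi : IsFBiharmonicMap g h f φ) : IsMinimal g h φ := by
  rw [isMinimal_iff_tension_eq_zero hφ]
  intro c hc d hd y hy
  -- The point under consideration supplies the nonemptiness required for a maximum.
  obtain ⟨x₀, -, hx₀⟩ := isCompact_univ.exists_isMaxOn ⟨c.symm y, Set.mem_univ _⟩
    (continuous_weightedTensionNormSq hφ hf.continuous).continuousOn
  have hzero : weightedTensionNormSq g h f φ x₀ = 0 := by
    set c := chartAt (Eucl m) x₀
    set d := chartAt (Eucl (m + 1)) (φ x₀)
    have hc : c ∈ IsManifold.maximalAtlas (𝓡 m) ∞ M := IsManifold.chart_mem_maximalAtlas x₀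
    have hd : d ∈ IsManifold.maximalAtlas (𝓡 (m + 1)) ∞ N :=
      IsManifold.chart_mem_maximalAtlas (φ x₀)
    have hxc : x₀ ∈ c.source := mem_chart_source _ x₀
    have hxd : φ x₀ ∈ d.source := mem_chart_source _ (φ x₀)
    have hF := hφ.isLocalIsometry hc hd
    have hy : c x₀ ∈ localDomain φ c d := ⟨c.map_source hxc, by rwa [c.left_inv hxc]⟩
    obtain ⟨μ, hμ⟩ := hEinstein
    have hFy := hF.mapsTo _ hy
    -- The scalar curvature is (m+1)μ, and m+1 is positive even when m = 0.
    have hμ0 : μ ≤ 0 := by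
      have h1 := hscal d hd _ hFy
      rw [hF.target.scal_eq hFy (hμ d hd _ hFy)] at h1
      have h2 : (0 : ℝ) < ((m + 1 : ℕ) : ℝ) := by positivity
      by_contra! h3
      exact absurd h1 (not_le.2 (mul_pos h2 h3))
    have hval : ∀ z ∈ localDomain φ c d, weightedTensionNormSq g h f φ (c.symm z)
        = f (c.symm z) ^ 2 * tensionNormSq (coeff g c) (coeff h d) (localRep φ c d) z := by
      intro z hz
      rw [weightedTensionNormSq_eq hφ f hc hd (c.map_target hz.1) hz.2, c.right_inv hz.1]
    have hmax : IsLocalMax (fun z => f (c.symm z) ^ 2 *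
        tensionNormSq (coeff g c) (coeff h d) (localRep φ c d) z) (c x₀) := by
      filter_upwards [hF.source.isOpen.mem_nhds hy] with z hz
      rw [← hval z hz, ← hval _ hy, c.left_inv hxc]
      exact hx₀ (Set.mem_univ _)
    have hτ := hF.tension_eq_zero_of_isLocalMax hμ0 hy (hμ d hd _ hFy)
      (f := fun z => f (c.symm z))
      (fun z hz => (hf.contMDiffAt.comp z
        (contMDiffAt_symm_of_mem_maximalAtlas hc hz.1)).contDiffAt)
      (hpos _) (hbi c hc d hd _ hy.1 hy.2) hmax
    rw [weightedTensionNormSq_eq hφ f hc hd hxc hxd, tensionNormSq, hτ]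
    simp
  have hF := hφ.isLocalIsometry hc hd
  have hle : weightedTensionNormSq g h f φ (c.symm y) ≤ weightedTensionNormSq g h f φ x₀ :=
    hx₀ (Set.mem_univ _)
  -- The global maximum of |fτ|² is 0, so f²|τ|² ≤ 0 at the arbitrary point y, and f > 0 gives τ = 0
  -- there.
  rw [hzero, weightedTensionNormSq_eq hφ f hc hd (c.map_target hy.1) hy.2, c.right_inv hy.1] at hle
  have hf2 : 0 < f (c.symm y) ^ 2 := pow_pos (hpos _) 2
  have hτ := eq_zero_of_form_self_nonpos (hF.target.posDef _ (hF.mapsTo y hy))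
    (nonpos_of_mul_nonpos_right hle hf2)
  exact fun a => congrFun hτ a

end Einstein

end RiemGeom

end

theorem theorem3p5 (m : ℕ)
    {M : Type*} [TopologicalSpace M] [T2Space M] [SecondCountableTopology M] [CompactSpace M]
    [ChartedSpace (RiemGeom.Eucl m) M] [IsManifold (𝓡 m) ∞ M]
    {N : Type*} [TopologicalSpace N] [T2Space N] [SecondCountableTopology N]
    [ChartedSpace (RiemGeom.Eucl (m + 1)) N] [IsManifold (𝓡 (m + 1)) ∞ N]
    (g : RiemGeom.Metric m M) (h : RiemGeom.Metric (m + 1) N)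
    (hEinstein : RiemGeom.IsEinstein h) (hscal : RiemGeom.NonposScal h)
    (φ : M → N) (hφ : RiemGeom.IsIsometricImmersion g h φ) :
    (RiemGeom.IsFBiharmonicSubmanifold g h φ ↔ RiemGeom.IsMinimal g h φ) ∧
    ∀ f : M → ℝ, ContMDiff (𝓡 m) 𝓘(ℝ, ℝ) ∞ f → (∀ x, 0 < f x) →
      (RiemGeom.IsFBiharmonicMap g h f φ ↔ RiemGeom.IsMinimal g h φ) := by
  refine ⟨⟨fun ⟨f, hf, hpos, hbi⟩ => hbi.isMinimal hEinstein hscal hφ hf hpos, fun hmin =>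
    ⟨fun _ => 1, contMDiff_const, fun _ => one_pos, hmin.isFBiharmonicMap hφ _⟩⟩, ?_⟩
  exact fun f hf hpos => ⟨fun hbi => hbi.isMinimal hEinstein hscal hφ hf hpos,
    fun hmin => hmin.isFBiharmonicMap hφ f⟩
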